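/- Let $n\ge 2$ and $0<c<1$. Let $E\subset\mathbb{R}^n$ belong to $\mathrm{UP}_n(c)$, i.e. $E$ is a compact set with at least two points such that $$\{x\in E:\ c\,r<|x-a|<r\}\neq\emptyset\qquad\text{for all } a\in E \text{ and } 0<r<d(E)/2,$$ where $d(E)$ is the diameter of $E$. Put $\beta=\dfrac{\log 2}{\log(3/c)}$. Then for every $a\in E$: 1. $$\Lambda^\beta\bigl(E\cap\overline{B}^n(a,r)\bigr)\ \ge\ \frac{r^\beta}{2\cdot 3^n},\qquad 0<r<d(E)/2,$$ where $\Lambda^\beta(S)=\inf\{\sum_k r_k^\beta : S\subset\bigcup_k B^n(a_k,r_k)\}$ (countable coverings by open balls) is the $\beta$-dimensional Hausdorff content. 2. $$\mathrm{cap}(a,E,r)\ \ge\ \frac{1}{2\cdot 3^n\,M_1(n,\beta)},\qquad 0<r<d(E).$$ Here $\mathrm{cap}(a,E,r)=\mathsf{M}(\Delta)$ is the conformal modulus of the family $\Delta$ of all curves joining the sphere $S^{n-1}(a,2r)$ to $E\cap\overline{B}^n(a,r)$ in $\mathbb{R}^n$, that is, $\mathsf{M}(\Delta)=\inf_\rho\int_{\mathbb{R}^n}\rho^n\,dm$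 over all Borel functions $\rho:\mathbb{R}^n\to[0,\infty]$ with $\int_\gamma\rho\,ds\ge1$ for every rectifiable $\gamma\in\Delta$. The same lower bound holds, for $0<r<d(E)$, for the conformal capacity of the condenser $(B^n(a,2r),\,E\cap\overline{B}^n(a,r))$, where the capacity of a condenser $(A,C)$ is $\inf_u\int_{\mathbb{R}^n}|\nabla u|^n\,dm$ over all non-negative $\mathrm{ACL}^n$ functions $u$ with compact support in $A$ and $u\ge1$ on $C$. The constant is $$M_1(n,\beta)=\max\Bigl\{\,2^{\beta+n}\Bigl(\frac{n-1}{\beta}\Bigr)^{n}\frac{N_n^*}{\Omega_n},\ \frac1{K_n}\Bigr\},\qquad K_n=2^{-n}\omega_{n-1}^{\,n}\,\Omega_n^{\,1-n},$$ where $\Omega_n$ is the volume of the unit ball, $\omega_{n-1}=n\Omega_n$ is the area of the unit sphere, and $N_n^*$ is the least integer $N$ with the following property: whenever a radius $r(x)>0$ is assigned to each point $x$ of a set $A\subset\mathbb{R}^n$ with $\sup_{x\in A} r(x)<\infty$, there is a countable $S\subset A$ such that the open balls $B^n(x,r(x))$, $x\in S$, cover $A$ and every point of $\mathbb{R}^n$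 lies in at most $N$ of them. -/

import Mathlib

namespace UnifPerfect

open Set MeasureTheory Metric
open scoped ENNReal

/-- Euclidean space `ℝⁿ`. -/
abbrev Rn (n : ℕ) : Type := EuclideanSpace ℝ (Fin n)

/-- The class `UP_n(c)`: compact sets `E ⊆ ℝⁿ` with at least two points such that
`{x ∈ E : c r < |x - a| < r} ≠ ∅` for all `a ∈ E` and `0 < r < d(E)/2`. -/
def UP (n : ℕ) (c : ℝ) : Set (Set (Rn n)) :=
  {E | IsCompact E ∧ E.Nontrivial ∧
    ∀ a ∈ E, ∀ r : ℝ, 0 < r → r < diam E / 2 →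
      {x | x ∈ E ∧ c * r < dist x a ∧ dist x a < r}.Nonempty}

/-- The `β`-dimensional Hausdorff content, `β > 0`: the infimum of `∑ r_k ^ β` over all countable
coverings by open balls `B(a_k, r_k)`. A ball of radius `0` is empty and contributes `0`, so that
finite coverings are included. -/
noncomputable def hausdorffContent {n : ℕ} (β : ℝ) (S : Set (Rn n)) : ℝ≥0∞ :=
  ⨅ (a : ℕ → Rn n) (r : ℕ → ℝ) (_ : ∀ k, 0 ≤ r k) (_ : S ⊆ ⋃ k, ball (a k) (r k)),
    ∑' k, ENNReal.ofReal (r k ^ β)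

/-! ### Modulus of a curve family -/

/-- A closed curve in `ℝⁿ`, parametrized by `[0,1]`; values outside `[0,1]` play no role. -/
def IsCurve {n : ℕ} (γ : ℝ → Rn n) : Prop := ContinuousOn γ (Icc 0 1)

/-- The length of a curve. -/
noncomputable def curveLength {n : ℕ} (γ : ℝ → Rn n) : ℝ≥0∞ := eVariationOn γ (Icc 0 1)

/-- The line integral `∫_γ ρ ds` of a rectifiable curve, that is, the integral over
`[0, length γ]` of `ρ` along the arc length parametrization of `γ`. -/
noncomputable def lineIntegral {n : ℕ} (ρ : Rn n → ℝ≥0∞) (γ : ℝ → Rn n) : ℝ≥0∞ :=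
  ∫⁻ s in Icc (0 : ℝ) (curveLength γ).toReal, ρ (naturalParameterization γ (Icc 0 1) 0 s)

/-- Admissible metrics of a curve family `Γ`: Borel functions `ρ : ℝⁿ → [0,∞]` with
`∫_γ ρ ds ≥ 1` for all rectifiable `γ ∈ Γ`. -/
def AdmissibleMetric {n : ℕ} (Γ : Set (ℝ → Rn n)) (ρ : Rn n → ℝ≥0∞) : Prop :=
  Measurable ρ ∧ ∀ γ ∈ Γ, curveLength γ ≠ ∞ → 1 ≤ lineIntegral ρ γ

/-- The conformal modulus `M(Γ) = inf_ρ ∫ ρⁿ dm`. -/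
noncomputable def modulus {n : ℕ} (Γ : Set (ℝ → Rn n)) : ℝ≥0∞ :=
  ⨅ (ρ : Rn n → ℝ≥0∞) (_ : AdmissibleMetric Γ ρ), ∫⁻ x, ρ x ^ n

/-- The family `Δ(F₁, F₂; G)` of all curves joining `F₁` and `F₂` in `G`: one endpoint lies in `F₁`,
the other one in `F₂`, and all other points of the curve lie in `G`. -/
def joiningCurves {n : ℕ} (F₁ F₂ G : Set (Rn n)) : Set (ℝ → Rn n) :=
  {γ | IsCurve γ ∧ ((γ 0 ∈ F₁ ∧ γ 1 ∈ F₂) ∨ (γ 0 ∈ F₂ ∧ γ 1 ∈ F₁)) ∧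
    ∀ t ∈ Ioo (0 : ℝ) 1, γ t ∈ G}

/-- `cap(x,E,r) = M(Δ(S(x,2r), E ∩ B̄(x,r); ℝⁿ))`. -/
noncomputable def relCap {n : ℕ} (x : Rn n) (E : Set (Rn n)) (r : ℝ) : ℝ≥0∞ :=
  modulus (joiningCurves (sphere x (2 * r)) (E ∩ closedBall x r) univ)

/-! ### Capacity of a condenser -/

/-- The `i`-th partial derivative (defined as `0` where it does not exist). -/
noncomputable def partialDeriv {n : ℕ} (i : Fin n) (u : Rn n → ℝ) (x : Rn n) : ℝ :=
  lineDeriv ℝ u x (EuclideanSpace.single i 1)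

/-- The gradient, as the vector of the partial derivatives. -/
noncomputable def grad {n : ℕ} (u : Rn n → ℝ) (x : Rn n) : Rn n :=
  WithLp.toLp 2 fun i => partialDeriv i u x

/-- `ACLⁿ` functions: continuous, absolutely continuous on compact segments of almost every line
parallel to a coordinate axis, with partial derivatives locally in `Lⁿ`. A set of lines parallel to
the `i`-th axis is null in the orthogonal hyperplane if and only if its union is null in `ℝⁿ`, so
"almost every line" is expressed as "the line through almost every point". -/
def IsACLn {n : ℕ} (u : Rn n → ℝ) : Prop :=
  Continuous u ∧
  (∀ i : Fin n, ∀ᵐ x : Rn n, ∀ a b : ℝ,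
    AbsolutelyContinuousOnInterval (fun t : ℝ => u (x + t • EuclideanSpace.single i 1)) a b) ∧
  ∀ i : Fin n, ∀ K : Set (Rn n), IsCompact K →
    MemLp (partialDeriv i u) (n : ℝ≥0∞) (volume.restrict K)

/-- Test functions of the condenser `(A, C)`: non-negative `ACLⁿ` functions with compact support
in `A` and with `u ≥ 1` on `C`. -/
def IsCapacityTest {n : ℕ} (A C : Set (Rn n)) (u : Rn n → ℝ) : Prop :=
  IsACLn u ∧ (∀ x, 0 ≤ u x) ∧ HasCompactSupport u ∧ tsupport u ⊆ A ∧ ∀ x ∈ C, 1 ≤ u x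

/-- The conformal capacity `inf_u ∫ |∇u|ⁿ dm` of the condenser `(A, C)`. -/
noncomputable def condenserCap {n : ℕ} (A C : Set (Rn n)) : ℝ≥0∞ :=
  ⨅ (u : Rn n → ℝ) (_ : IsCapacityTest A C u), ∫⁻ x, ‖grad u x‖ₑ ^ n

/-! ### The constant `M₁(n, β)` -/

/-- `N` is an admissible bound in the covering lemma in `ℝⁿ`: whenever radii `ρ x > 0`, bounded
above, are assigned to the points `x` of a set `A`, there is a countable `S ⊆ A` such that the
open balls `B(x, ρ x)`, `x ∈ S`, cover `A` and no point lies in more than `N` of them. -/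
def CoveringBound (n N : ℕ) : Prop :=
  ∀ (A : Set (Rn n)) (ρ : Rn n → ℝ), (∀ x ∈ A, 0 < ρ x) → (∃ R, ∀ x ∈ A, ρ x ≤ R) →
    ∃ S ⊆ A, S.Countable ∧ A ⊆ ⋃ x ∈ S, ball x (ρ x) ∧
      ∀ y, {x | x ∈ S ∧ y ∈ ball x (ρ x)}.encard ≤ N

/-- `N_n^*`, the least admissible bound in the covering lemma. -/
noncomputable def coveringNumber (n : ℕ) : ℕ := sInf {N | CoveringBound n N}

theorem exists_coveringBound (n : ℕ) : ∃ N, CoveringBound n N := by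
  obtain ⟨N, τ, hτ, hN⟩ := HasBesicovitchCovering.no_satelliteConfig (α := Rn n)
  refine ⟨N, fun A ρ hpos ⟨R, hR⟩ => ?_⟩
  let q : Besicovitch.BallPackage A (Rn n) :=
    ⟨fun x => x, fun x => ρ x, fun x => hpos x x.2, R, fun x => hR x x.2⟩
  obtain ⟨s, hs, hcov⟩ := Besicovitch.exist_disjoint_covering_families hτ hN q
  refine ⟨Subtype.val '' (⋃ i, s i), ?_, ?_, ?_, fun y => ?_⟩
  · rintro _ ⟨x, -, rfl⟩
    exact x.2
  · refine (countable_iUnion fun i => ?_).image _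
    refine (hs i).countable_of_nonempty_interior fun x _ => ?_
    exact ⟨x, ball_subset_interior_closedBall (mem_ball_self (hpos x x.2))⟩
  · intro x hx
    have h := hcov ⟨⟨x, hx⟩, rfl⟩
    simp only [mem_iUnion] at h ⊢
    obtain ⟨i, j, hj, h⟩ := h
    exact ⟨j, ⟨j, mem_iUnion.2 ⟨i, hj⟩, rfl⟩, h⟩
  · let T : Fin N → Set (Rn n) := fun i => {x | (∃ z ∈ s i, (z : Rn n) = x) ∧ y ∈ ball x (ρ x)}
    have hT : ∀ i, (T i).Subsingleton := by
      rintro i _ ⟨⟨z, hz, rfl⟩, hyz⟩ _ ⟨⟨w, hw, rfl⟩, hyw⟩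
      by_contra hne
      have hzw : z ≠ w := fun h => hne (by rw [h])
      exact disjoint_left.1 (hs i hz hw hzw) (ball_subset_closedBall hyz)
        (ball_subset_closedBall hyw)
    have hsub : {x | x ∈ Subtype.val '' (⋃ i, s i) ∧ y ∈ ball x (ρ x)} ⊆ ⋃ i, T i := by
      rintro _ ⟨⟨z, hz, rfl⟩, hy⟩
      obtain ⟨i, hi⟩ := mem_iUnion.1 hz
      exact mem_iUnion.2 ⟨i, ⟨z, hi, rfl⟩, hy⟩
    have hidx : ∀ x : ↥(⋃ i, T i), ∃ i, (x : Rn n) ∈ T i := fun x => mem_iUnion.1 x.2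
    choose f hf using hidx
    have hinj : Function.Injective f := fun x z hxz =>
      Subtype.ext (hT (f x) (hf x) (hxz ▸ hf z))
    calc _ ≤ (⋃ i, T i).encard := encard_le_encard hsub
      _ = ENat.card ↥(⋃ i, T i) := rfl
      _ ≤ ENat.card (Fin N) := ENat.card_le_card_of_injective hinj
      _ = N := by simp

theorem coveringBound_coveringNumber (n : ℕ) : CoveringBound n (coveringNumber n) :=
  Nat.sInf_mem (exists_coveringBound n)

/-- The volume `Ω_n` of the unit ball of `ℝⁿ`. -/
noncomputable def unitBallVol (n : ℕ) : ℝ := volume.real (ball (0 : Rn n) 1)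

/-- The area `ω_{n-1} = n Ω_n` of the unit sphere of `ℝⁿ`. -/
noncomputable def unitSphereArea (n : ℕ) : ℝ := n * unitBallVol n

/-- `K_n = 2^{-n} ω_{n-1}^n Ω_n^{1-n}`. -/
noncomputable def Kconst (n : ℕ) : ℝ :=
  2 ^ (-(n : ℝ)) * unitSphereArea n ^ n * unitBallVol n ^ (1 - (n : ℝ))

/-- `M₁(n, β) = max {2^{β+n} ((n-1)/β)^n N_n^* / Ω_n, 1/K_n}`. -/
noncomputable def M₁ (n : ℕ) (β : ℝ) : ℝ :=
  max (2 ^ (β + n) * (((n : ℝ) - 1) / β) ^ n * coveringNumber n / unitBallVol n) (1 / Kconst n)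

end UnifPerfect

/-!
The Hausdorff content bound is a mass distribution argument. Put `q = c / 3`, so that
`q ^ β = 1 / 2`. Uniform perfectness provides, in every ball of radius `s` centred at `x ∈ E`, a
second point of `E` such that the balls of radius `q s` around the two points are disjoint and lie
in the given ball. Iteration yields a binary tree (`treePoint`) whose `2 ^ k` balls of radius
`R q ^ k` at level `k` are disjoint and nested between levels. Counting the level `k` balls that
meet a ball of radius `t ≈ R q ^ k`, by volume, shows that such a ball carries at most
`(3 / 2) * 3 ^ n * (t / R) ^ β` of the equidistributed mass (`card_treePoint_mem_ball_le`). The root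
radius `R = 3 r / 4` is admissible for all `r < d(E)`, as the capacity bounds require, and
`(4 / 3) ^ β ≤ 4 / 3` turns the constant into `2 * 3 ^ n`.

Both capacity bounds follow from one statement about functions on `ball a (2 * r)`
(`le_lintegral_pow_of_rays`): if `g` has integral at least `1` along every ray issuing from the
points of a set `C`, then polar coordinates at `x ∈ C` bound the integral of `g` against the kernel
`|y - x| ^ (1 - n)` below by the area of the unit sphere. The kernel is an integral over the balls
around `x`. Either the large balls contribute half of the total, and then Hölder's inequality gives
energy at least `K_n`; or the energy of `g` in some ball `ball x t` exceeds a multiple of `t ^ β`,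
and then the covering lemma bounds the content of `C` by a multiple of the energy.

For the modulus, the hypothesis on rays holds for an admissible metric because the radial segments
belong to the curve family. For the condenser, a test function `u` is mollified. Absolute continuity
on almost every line parallel to an axis gives `∂ᵢ(u * φ) = (∂ᵢu) * φ`
(`IsACLn.fderiv_mollify`), so the fundamental theorem of calculus along rays applies to `u * φ`
with `|∇u| * φ` as a bound for the derivative, and by Jensen's inequality convolution with `φ`
does not increase the energy.
-/

namespace UnifPerfect

open Set MeasureTheory Metric
open scoped ENNReal

/-! ### Hausdorff content of uniformly perfect sets -/

/-- A binary tree of points with root `a`: the `2 ^ k` points of level `k` are indexed by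
`i < 2 ^ k`, and the two children of `x`, a point of level `k`, are `x` itself and
`f x (R * q ^ k)`. -/
def treePoint {X : Type*} (f : X → ℝ → X) (a : X) (R q : ℝ) : ℕ → ℕ → X
  | 0, _ => a
  | k + 1, i =>
    if i % 2 = 0 then treePoint f a R q k (i / 2)
    else f (treePoint f a R q k (i / 2)) (R * q ^ k)

/-- `f x s` is a point of `E` in the annulus of radii `2 q s` and `2 s / 3` around `x`, so that the
closed balls of radius `q s` around `x` and `f x s` are disjoint and contained in the closed ball of
radius `s` around `x`. -/
def IsBranching {X : Type*} [PseudoMetricSpace X] (E : Set X) (q R : ℝ) (f : X → ℝ → X) : Prop :=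
  ∀ x ∈ E, ∀ s : ℝ, 0 < s → s ≤ R →
    f x s ∈ E ∧ 2 * (q * s) < dist (f x s) x ∧ dist (f x s) x < 2 * s / 3

section Tree

variable {X : Type*} [PseudoMetricSpace X] {E : Set X} {q R : ℝ} {f : X → ℝ → X} {a : X}

lemma mul_pow_le_self (hR : 0 < R) (hq : 0 < q) (hq3 : q ≤ 1 / 3) (k : ℕ) : R * q ^ k ≤ R :=
  mul_le_of_le_one_right hR.le (pow_le_one₀ hq.le (by linarith))

lemma treePoint_mem (hR : 0 < R) (hq : 0 < q) (hq3 : q ≤ 1 / 3) (hf : IsBranching E q R f)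
    (ha : a ∈ E) : ∀ k i, treePoint f a R q k i ∈ E
  | 0, _ => ha
  | k + 1, i => by
    rw [treePoint]
    split_ifs
    · exact treePoint_mem hR hq hq3 hf ha k _
    · exact (hf _ (treePoint_mem hR hq hq3 hf ha k _) _ (by positivity)
        (mul_pow_le_self hR hq hq3 k)).1

lemma dist_treePoint_succ (hR : 0 < R) (hq : 0 < q) (hq3 : q ≤ 1 / 3) (hf : IsBranching E q R f)
    (ha : a ∈ E) (k i : ℕ) :
    dist (treePoint f a R q (k + 1) i) (treePoint f a R q k (i / 2)) + R * q ^ (k + 1)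
      ≤ R * q ^ k := by
  have hk : 0 < R * q ^ k := by positivity
  have h3 : R * q ^ (k + 1) ≤ R * q ^ k / 3 := by
    rw [pow_succ]; nlinarith
  rw [treePoint]
  split_ifs
  · rw [dist_self]; linarith
  · have := (hf _ (treePoint_mem hR hq hq3 hf ha k (i / 2)) _ hk (mul_pow_le_self hR hq hq3 k)).2.2
    linarith

/-- The ball of a point of level `k + m` lies in the ball of its ancestor of level `k`. -/
lemma dist_treePoint_add (hR : 0 < R) (hq : 0 < q) (hq3 : q ≤ 1 / 3) (hf : IsBranching E q R f)
    (ha : a ∈ E) (k : ℕ) : ∀ m i,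
    dist (treePoint f a R q (k + m) i) (treePoint f a R q k (i / 2 ^ m)) + R * q ^ (k + m)
      ≤ R * q ^ k
  | 0, i => by simp
  | m + 1, i => by
    have h1 := dist_treePoint_succ hR hq hq3 hf ha (k + m) i
    have h2 := dist_treePoint_add hR hq hq3 hf ha k m (i / 2)
    rw [Nat.div_div_eq_div_mul, ← pow_succ'] at h2
    have := dist_triangle (treePoint f a R q (k + m + 1) i) (treePoint f a R q (k + m) (i / 2))
      (treePoint f a R q k (i / 2 ^ (m + 1)))
    rw [← add_assoc]
    linarith

lemma disjoint_closedBall_treePoint (hR : 0 < R) (hq : 0 < q) (hq3 : q ≤ 1 / 3)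
    (hf : IsBranching E q R f) (ha : a ∈ E) : ∀ k i j, i < 2 ^ k → j < 2 ^ k → i ≠ j →
    Disjoint (closedBall (treePoint f a R q k i) (R * q ^ k))
      (closedBall (treePoint f a R q k j) (R * q ^ k))
  | 0, i, j, hi, hj, hij => by omega
  | k + 1, i, j, hi, hj, hij => by
    rw [pow_succ] at hi hj
    by_cases h : i / 2 = j / 2
    · have hk : 0 < R * q ^ k := by positivity
      -- the two points are the two children of the same point
      have := (hf _ (treePoint_mem hR hq hq3 hf ha k (i / 2)) _ hk
        (mul_pow_le_self hR hq hq3 k)).2.1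
      have e : q * (R * q ^ k) = R * q ^ (k + 1) := by ring
      rw [e] at this
      apply closedBall_disjoint_closedBall
      rw [← two_mul]
      rcases Nat.mod_two_eq_zero_or_one i with hi2 | hi2 <;>
        rcases Nat.mod_two_eq_zero_or_one j with hj2 | hj2
      · omega
      · rw [treePoint, treePoint, if_pos hi2, if_neg (by omega), ← h, dist_comm]; exact this
      · rw [treePoint, treePoint, if_neg (by omega), if_pos hj2, ← h]; exact this
      · omega
    · exact (disjoint_closedBall_treePoint hR hq hq3 hf ha k (i / 2) (j / 2) (by omega) (by omega)
        h).mono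
        (closedBall_subset_closedBall' (by
          linarith [dist_treePoint_succ hR hq hq3 hf ha k i]))
        (closedBall_subset_closedBall' (by
          linarith [dist_treePoint_succ hR hq hq3 hf ha k j]))

end Tree

/-- Disjoint closed balls of radius `s` with centres at distance at most `t + s` from `x` lie in
`closedBall x (t + 2 * s)`, and comparison of volumes bounds their number. -/
lemma card_mul_pow_le_of_disjoint_closedBall {n : ℕ} {ι : Type*} (J : Finset ι) (p : ι → Rn n)
    (x : Rn n) {s t : ℝ} (hs : 0 < s) (ht : 0 ≤ t)
    (hd : ∀ i ∈ J, ∀ j ∈ J, i ≠ j → Disjoint (closedBall (p i) s) (closedBall (p j) s))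
    (hx : ∀ i ∈ J, dist (p i) x ≤ t + s) :
    (J.card : ℝ) * s ^ n ≤ (t + 2 * s) ^ n := by
  have h1 : volume (⋃ i ∈ J, closedBall (p i) s) ≤ volume (closedBall x (t + 2 * s)) :=
    measure_mono (iUnion₂_subset fun i hi =>
      closedBall_subset_closedBall' (by linarith [hx i hi]))
  rw [measure_biUnion_finset (fun i hi j hj hij => hd i hi j hj hij)
    (fun i _ => isClosed_closedBall.measurableSet)] at h1
  simp_rw [Measure.addHaar_closedBall volume _ hs.le,
    Measure.addHaar_closedBall volume x (show 0 ≤ t + 2 * s by positivity)] at h1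
  rw [Finset.sum_const, nsmul_eq_mul, ← mul_assoc, finrank_euclideanSpace_fin] at h1
  have h2 := (ENNReal.mul_le_mul_iff_left (measure_ball_pos volume (0 : Rn n) one_pos).ne'
    measure_ball_lt_top.ne).1 h1
  rw [← ENNReal.ofReal_natCast, ← ENNReal.ofReal_mul (by positivity)] at h2
  exact (ENNReal.ofReal_le_ofReal_iff (by positivity)).1 h2

/-- The volume ratio `(2 + τ) ^ n` in the count of balls, compared with `s = τ ^ β`. On `s ≥ 1 / 2`
the constant `3 / 2` suffices instead of the `2` that the crude bound `2 + τ ≤ 3` would give; this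
gain pays for a root radius smaller than `r`. -/
lemma two_add_pow_le {n : ℕ} (hn : 2 ≤ n) {τ s : ℝ} (h0 : 0 ≤ τ) (hτ : τ ≤ s) (hs : 1 / 2 ≤ s)
    (hs1 : s ≤ 1) : (2 + τ) ^ n ≤ 3 / 2 * 3 ^ n * s := by
  have h1 : ((2 + τ) / 3) ^ n ≤ ((2 + s) / 3) ^ 2 :=
    (pow_le_pow_of_le_one (by positivity) (by linarith) hn).trans
      (pow_le_pow_left₀ (by positivity) (by linarith) 2)
  have h2 : ((2 + s) / 3) ^ 2 ≤ 3 / 2 * s := by nlinarith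
  have h3 : (2 + τ) ^ n = 3 ^ n * ((2 + τ) / 3) ^ n := by
    rw [← mul_pow]; congr 1; ring
  rw [h3]
  have : (0 : ℝ) < 3 ^ n := by positivity
  nlinarith

/-- The proportion of the points of level `K` lying in a ball of radius `t ≥ R q ^ K` is at most
`(3 / 2) 3 ^ n (t / R) ^ β`. -/
lemma card_treePoint_mem_ball_le {n : ℕ} (hn : 2 ≤ n) {E : Set (Rn n)} {q R β : ℝ}
    {f : Rn n → ℝ → Rn n} {a : Rn n} (hR : 0 < R) (hq : 0 < q) (hq3 : q ≤ 1 / 3)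
    (hβ0 : 0 < β) (hβ1 : β ≤ 1) (hqβ : q ^ β = 1 / 2)
    (hf : IsBranching E q R f) (ha : a ∈ E) (K : ℕ) (x : Rn n) {t : ℝ} (ht : R * q ^ K ≤ t) :
    (({i ∈ Finset.range (2 ^ K) | dist (treePoint f a R q K i) x < t}.card : ℕ) : ℝ) ≤
      2 ^ K * (3 / 2 * 3 ^ n * (t / R) ^ β) := by
  have ht0 : 0 < t := lt_of_lt_of_le (by positivity) ht
  have hq1 : q < 1 := by linarith
  rcases le_or_gt R t with htR | htR
  · have h1 : (1 : ℝ) ≤ (t / R) ^ β := Real.one_le_rpow ((one_le_div hR).2 htR) hβ0.le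
    have h2 : (1 : ℝ) ≤ 3 ^ n := one_le_pow₀ (by norm_num)
    calc _ ≤ (((Finset.range (2 ^ K)).card : ℕ) : ℝ) := by
          exact_mod_cast Finset.card_filter_le _ _
      _ = 2 ^ K * 1 := by simp
      _ ≤ _ := by gcongr; nlinarith
  -- the level whose balls have radius comparable to `t`
  obtain ⟨k, hk1, hk2⟩ := exists_nat_pow_near_of_lt_one (div_pos ht0 hR)
    ((div_le_one hR).2 htR.le) hq hq1
  have hkK : k ≤ K := by
    have : q ^ K ≤ q ^ k := le_trans ((le_div_iff₀ hR).2 (by rwa [mul_comm])) hk2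
    exact (pow_le_pow_iff_right_of_lt_one₀ hq hq1).1 this
  obtain ⟨m, rfl⟩ := Nat.exists_eq_add_of_le hkK
  set S := {i ∈ Finset.range (2 ^ (k + m)) | dist (treePoint f a R q (k + m) i) x < t} with hS
  -- the ancestors of level `k`
  set J := S.image (fun i => i / 2 ^ m) with hJ
  have hqk : 0 < q ^ k := by positivity
  have hk0 : 0 < R * q ^ k := by positivity
  have hSJ : S.card ≤ 2 ^ m * J.card := by
    refine Finset.card_le_mul_card_image _ _ fun j _ => ?_
    calc _ ≤ (Finset.Ico (j * 2 ^ m) ((j + 1) * 2 ^ m)).card := by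
          refine Finset.card_le_card fun i hi => ?_
          rw [Finset.mem_filter] at hi
          rw [Finset.mem_Ico]
          exact (Nat.div_eq_iff (by positivity)).1 hi.2 |>.imp id (fun h => by
            have : 0 < 2 ^ m := by positivity
            rw [add_mul]; omega)
      _ = 2 ^ m := by rw [Nat.card_Ico, add_mul, one_mul, Nat.add_sub_cancel_left]
  have hJlt : ∀ j ∈ J, j < 2 ^ k ∧ dist (treePoint f a R q k j) x ≤ t + R * q ^ k := by
    intro j hj
    obtain ⟨i, hi, rfl⟩ := Finset.mem_image.1 hj
    rw [hS, Finset.mem_filter, Finset.mem_range] at hi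
    refine ⟨Nat.div_lt_of_lt_mul (by rw [← pow_add, add_comm]; exact hi.1), ?_⟩
    have h1 := dist_treePoint_add hR hq hq3 hf ha k m i
    have h2 := dist_triangle_left (treePoint f a R q k (i / 2 ^ m)) x
      (treePoint f a R q (k + m) i)
    have h3 : 0 < R * q ^ (k + m) := by positivity
    linarith [hi.2]
  have hcard := card_mul_pow_le_of_disjoint_closedBall J (treePoint f a R q k) x hk0 ht0.le
    (fun i hi j hj hij => disjoint_closedBall_treePoint hR hq hq3 hf ha k i j (hJlt i hi).1
      (hJlt j hj).1 hij) (fun i hi => (hJlt i hi).2)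
  set τ := t / R / q ^ k with hτ
  have hτ0 : 0 < τ := by positivity
  have hτ1 : τ ≤ 1 := (div_le_one hqk).2 hk2
  have hτq : q ≤ τ := (le_div_iff₀ hqk).2 (by rw [← pow_succ']; exact hk1.le)
  have htτ : t = τ * (R * q ^ k) := by rw [hτ]; field_simp
  have hJ2 : (J.card : ℝ) ≤ (2 + τ) ^ n := by
    have e : t + 2 * (R * q ^ k) = (2 + τ) * (R * q ^ k) := by rw [htτ]; ring
    rw [e, mul_pow (2 + τ)] at hcard
    exact le_of_mul_le_mul_right hcard (by positivity)
  have hqkβ : (q ^ k) ^ β = (1 / 2) ^ k := by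
    rw [← Real.rpow_natCast, ← Real.rpow_mul hq.le, mul_comm, Real.rpow_mul hq.le, hqβ,
      Real.rpow_natCast]
  have hmain := two_add_pow_le hn hτ0.le
    (by simpa using Real.rpow_le_rpow_of_exponent_ge hτ0 hτ1 hβ1 : τ ≤ τ ^ β)
    (hqβ ▸ Real.rpow_le_rpow hq.le hτq hβ0.le) (Real.rpow_le_one hτ0.le hτ1 hβ0.le)
  have htR : (t / R) ^ β = τ ^ β * (1 / 2) ^ k := by
    rw [← hqkβ, ← Real.mul_rpow hτ0.le hqk.le]; congr 1; rw [hτ]; field_simp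
  calc (S.card : ℝ) ≤ 2 ^ m * J.card := by exact_mod_cast hSJ
    _ ≤ 2 ^ m * (3 / 2 * 3 ^ n * τ ^ β) := by gcongr; exact hJ2.trans hmain
    _ = _ := by
      rw [htR, pow_add, div_pow, one_pow]; field_simp

/-- The annulus of outer radius `2 * s / 3 < d(E) / 2` and inner radius `c` times that. -/
lemma exists_isBranching {n : ℕ} {c : ℝ} {E : Set (Rn n)} (hE : E ∈ UP n c) {R : ℝ}
    (hR : R < 3 / 4 * diam E) : ∃ f, IsBranching E (c / 3) R f := by
  have : ∀ x s, ∃ y, x ∈ E → 0 < s → s ≤ R →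
      y ∈ E ∧ 2 * (c / 3 * s) < dist y x ∧ dist y x < 2 * s / 3 := by
    intro x s
    by_cases h : x ∈ E ∧ 0 < s ∧ s ≤ R
    · obtain ⟨y, hy, h1, h2⟩ := hE.2.2 x h.1 (2 * s / 3) (by linarith) (by linarith)
      exact ⟨y, fun _ _ _ => ⟨hy, by linarith, h2⟩⟩
    · exact ⟨x, fun h1 h2 h3 => (h ⟨h1, h2, h3⟩).elim⟩
  choose f hf using this
  exact ⟨f, fun x hx s hs hsR => hf x s hx hs hsR⟩

/-- The Hausdorff content of a uniformly perfect set. The equidistributed masses on the levels of a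
binary tree of points of `E` play the role of a Frostman measure; a ball of radius `t` carries at
most the mass `2 * 3 ^ n * (t / r) ^ β`. -/
lemma le_hausdorffContent {n : ℕ} (hn : 2 ≤ n) {c : ℝ} (hc0 : 0 < c) (hc1 : c < 1)
    {E : Set (Rn n)} (hE : E ∈ UP n c) {a : Rn n} (ha : a ∈ E) {β : ℝ} (hβ0 : 0 < β) (hβ1 : β ≤ 1)
    (hqβ : (c / 3) ^ β = 1 / 2) {r : ℝ} (hr : 0 < r) (hrd : r < diam E) :
    ENNReal.ofReal (r ^ β / (2 * 3 ^ n)) ≤ hausdorffContent β (E ∩ closedBall a r) := by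
  set q := c / 3 with hq_def
  have hq : 0 < q := by positivity
  have hq3 : q ≤ 1 / 3 := by rw [hq_def]; linarith
  -- the root ball is slightly smaller than `closedBall a r`, since `E` is only known to meet
  -- annuli of outer radius less than half the diameter
  set R := 3 / 4 * r with hR_def
  have hR : 0 < R := by positivity
  obtain ⟨f, hf⟩ := exists_isBranching hE (R := R) (by rw [hR_def]; linarith)
  refine le_iInf fun b => le_iInf fun s => le_iInf fun hs => le_iInf fun hcov => ?_
  have hcomp : IsCompact (E ∩ closedBall a r) := hE.1.inter_right isClosed_closedBall
  obtain ⟨T, hT⟩ := hcomp.elim_finite_subcover _ (fun k => isOpen_ball) hcov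
  set T' := {k ∈ T | 0 < s k} with hT'
  obtain ⟨K, hK⟩ : ∃ K : ℕ, ∀ k ∈ T', R * q ^ K ≤ s k := by
    have hlim : Filter.Tendsto (fun K : ℕ => R * q ^ K) Filter.atTop (nhds 0) := by
      simpa using (tendsto_pow_atTop_nhds_zero_of_lt_one hq.le (by linarith)).const_mul R
    have : ∀ᶠ K in Filter.atTop, ∀ k ∈ T', R * q ^ K ≤ s k := by
      rw [Filter.eventually_all_finset]
      intro k hk
      rw [hT', Finset.mem_filter] at hk
      exact (hlim.eventually (ge_mem_nhds hk.2))
    exact this.exists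
  have hcount : ((2 : ℝ) ^ K) ≤ ∑ k ∈ T', 2 ^ K * (3 / 2 * 3 ^ n * (s k / R) ^ β) := by
    have h1 : Finset.range (2 ^ K) ⊆ T'.biUnion fun k =>
        {i ∈ Finset.range (2 ^ K) | dist (treePoint f a R q K i) (b k) < s k} := by
      intro i hi
      have hmem : treePoint f a R q K i ∈ E ∩ closedBall a r := by
        refine ⟨treePoint_mem hR hq hq3 hf ha K i, ?_⟩
        have h2 := dist_treePoint_add hR hq hq3 hf ha 0 K i
        have h3 : 0 < R * q ^ K := by positivity
        rw [zero_add, treePoint, pow_zero, mul_one] at h2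
        rw [mem_closedBall]
        rw [hR_def] at h2 h3 ⊢
        linarith
      obtain ⟨k, hk, hik⟩ := mem_iUnion₂.1 (hT hmem)
      rw [mem_ball] at hik
      refine Finset.mem_biUnion.2 ⟨k, ?_, ?_⟩
      · exact Finset.mem_filter.2 ⟨hk, dist_nonneg.trans_lt hik⟩
      · exact Finset.mem_filter.2 ⟨hi, hik⟩
    have h2 := (Finset.card_le_card h1).trans Finset.card_biUnion_le
    rw [Finset.card_range] at h2
    calc ((2 : ℝ) ^ K) ≤ ∑ k ∈ T',
          (({i ∈ Finset.range (2 ^ K) | dist (treePoint f a R q K i) (b k) < s k}.card : ℕ) : ℝ) :=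
        by exact_mod_cast h2
      _ ≤ _ := Finset.sum_le_sum fun k hk =>
        card_treePoint_mem_ball_le hn hR hq hq3 hβ0 hβ1 hqβ hf ha K (b k) (hK k hk)
  rw [← Finset.mul_sum] at hcount
  have h1 : 1 ≤ ∑ k ∈ T', (3 / 2 * 3 ^ n * (s k / R) ^ β) :=
    le_of_mul_le_mul_left (by rwa [mul_one]) (by positivity : (0 : ℝ) < 2 ^ K)
  have h2 : ∀ k ∈ T', 3 / 2 * 3 ^ n * (s k / R) ^ β ≤ 2 * 3 ^ n / r ^ β * s k ^ β := by
    intro k _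
    have e : s k / R = 4 / 3 * (s k / r) := by rw [hR_def]; field_simp
    have h43 : (4 / 3 : ℝ) ^ β ≤ 4 / 3 := by
      simpa using Real.rpow_le_rpow_of_exponent_le (by norm_num : (1 : ℝ) ≤ 4 / 3) hβ1
    rw [e, Real.mul_rpow (by norm_num) (div_nonneg (hs k) hr.le), Real.div_rpow (hs k) hr.le]
    have h0 : 0 ≤ s k ^ β / r ^ β := div_nonneg (Real.rpow_nonneg (hs k) _) (by positivity)
    calc 3 / 2 * 3 ^ n * ((4 / 3) ^ β * (s k ^ β / r ^ β))
        ≤ 3 / 2 * 3 ^ n * (4 / 3 * (s k ^ β / r ^ β)) := by gcongr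
      _ = _ := by ring
  have h3 := h1.trans (Finset.sum_le_sum h2)
  rw [← Finset.mul_sum] at h3
  have h4 : r ^ β / (2 * 3 ^ n) ≤ ∑ k ∈ T', s k ^ β := by
    have hrβ : 0 < r ^ β := by positivity
    rw [div_le_iff₀ (by positivity)]
    rw [div_mul_eq_mul_div, le_div_iff₀ hrβ, one_mul] at h3
    linarith
  calc _ ≤ ENNReal.ofReal (∑ k ∈ T', s k ^ β) := ENNReal.ofReal_le_ofReal h4
    _ = ∑ k ∈ T', ENNReal.ofReal (s k ^ β) :=
      ENNReal.ofReal_sum_of_nonneg fun k _ => Real.rpow_nonneg (hs k) _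
    _ ≤ _ := ENNReal.sum_le_tsum _

/-! ### Polar coordinates and integrals over rays -/

/-- Hölder's inequality against the constant `1`. -/
lemma lintegral_pow_le_measure_pow_mul {α : Type*} [MeasurableSpace α] (μ : Measure α) {n : ℕ}
    (hn : 1 ≤ n) {g : α → ℝ≥0∞} (hg : AEMeasurable g μ) :
    (∫⁻ x, g x ∂μ) ^ n ≤ μ univ ^ (n - 1) * ∫⁻ x, g x ^ n ∂μ := by
  have hn0 : (n : ℝ) ≠ 0 := by positivity
  have hn1 : (1 : ℝ) ≤ n := by exact_mod_cast hn
  have h := ENNReal.lintegral_mul_norm_pow_le (μ := μ) (f := fun x => g x ^ n) (g := fun _ => 1)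
    (hg.pow_const n) aemeasurable_const (p := 1 / n) (q := 1 - 1 / n) (by positivity)
    (by rw [sub_nonneg, div_le_one (by positivity)]; exact hn1) (by ring)
  have e : ∀ x, (g x ^ n) ^ (1 / n : ℝ) * (1 : ℝ≥0∞) ^ (1 - 1 / n : ℝ) = g x := by
    intro x
    rw [ENNReal.one_rpow, mul_one, ← ENNReal.rpow_natCast, ← ENNReal.rpow_mul,
      mul_one_div_cancel hn0, ENNReal.rpow_one]
  simp only [e] at h
  rw [lintegral_const, one_mul] at h
  refine (pow_le_pow_left' h n).trans_eq ?_
  rw [mul_pow, ← ENNReal.rpow_natCast, ← ENNReal.rpow_mul, one_div_mul_cancel hn0,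
    ENNReal.rpow_one, ← ENNReal.rpow_natCast (μ univ ^ (1 - 1 / n : ℝ)), ← ENNReal.rpow_mul,
    sub_mul, one_mul, one_div_mul_cancel hn0, mul_comm, ← ENNReal.rpow_natCast (μ univ) (n - 1),
    Nat.cast_sub hn, Nat.cast_one]

/-- Integration in polar coordinates. -/
lemma lintegral_eq_lintegral_toSphere {n : ℕ} (hn : 1 ≤ n) {h : Rn n → ℝ≥0∞} (hh : Measurable h) :
    ∫⁻ y, h y = ∫⁻ e : sphere (0 : Rn n) 1, (∫⁻ t in Ioi (0 : ℝ),
      ENNReal.ofReal (t ^ (n - 1)) * h (t • (e : Rn n))) ∂(volume : Measure (Rn n)).toSphere := by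
  have : Nonempty (Fin n) := ⟨⟨0, hn⟩⟩
  have hm : Measurable fun p : sphere (0 : Rn n) 1 × Ioi (0 : ℝ) =>
      h ((p.2 : ℝ) • (p.1 : Rn n)) := hh.comp (by fun_prop)
  calc ∫⁻ y, h y = ∫⁻ y in ({0}ᶜ : Set (Rn n)), h y := by rw [restrict_compl_singleton]
    _ = ∫⁻ y : ({0}ᶜ : Set (Rn n)), h y ∂(volume.comap Subtype.val) :=
      (lintegral_subtype_comap (measurableSet_singleton 0).compl h).symm
    _ = ∫⁻ p, h ((p.2 : ℝ) • (p.1 : Rn n)) ∂((volume : Measure (Rn n)).toSphere.prod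
          (Measure.volumeIoiPow (n - 1))) := by
      have := (volume : Measure (Rn n)).measurePreserving_homeomorphUnitSphereProd
      rw [finrank_euclideanSpace_fin] at this
      rw [← this.lintegral_comp hm]
      refine lintegral_congr fun y => ?_
      have hy := (homeomorphUnitSphereProd (Rn n)).symm_apply_apply y
      conv_lhs => rw [← hy]
      rw [homeomorphUnitSphereProd_symm_apply_coe]
    _ = _ := by
      rw [lintegral_prod _ hm.aemeasurable]
      refine lintegral_congr fun e => ?_
      have he : Measurable fun t : Ioi (0 : ℝ) => h ((t : ℝ) • (e : Rn n)) :=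
        hm.comp measurable_prodMk_left
      rw [Measure.volumeIoiPow, lintegral_withDensity_eq_lintegral_mul _ (by fun_prop) he]
      exact lintegral_subtype_comap measurableSet_Ioi
        (fun t : ℝ => ENNReal.ofReal (t ^ (n - 1)) * h (t • (e : Rn n)))

lemma ofReal_unitBallVol (n : ℕ) :
    ENNReal.ofReal (unitBallVol n) = volume (ball (0 : Rn n) 1) :=
  ENNReal.ofReal_toReal measure_ball_lt_top.ne

lemma unitBallVol_pos (n : ℕ) : 0 < unitBallVol n := by
  rw [← ENNReal.ofReal_pos, ofReal_unitBallVol]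
  exact measure_ball_pos _ _ one_pos

lemma toSphere_univ (n : ℕ) : (volume : Measure (Rn n)).toSphere univ =
    ENNReal.ofReal (n * unitBallVol n) := by
  rw [Measure.toSphere_apply_univ, finrank_euclideanSpace_fin, ENNReal.ofReal_mul (by positivity),
    ENNReal.ofReal_natCast, ofReal_unitBallVol]

/-- The kernel `s ^ (1 - n)` as a superposition of indicator functions of balls. -/
lemma lintegral_Ioi_rpow_neg {n : ℕ} (hn : 2 ≤ n) {s : ℝ} (hs : 0 < s) :
    ∫⁻ t in Ioi s, ENNReal.ofReal ((n - 1) * t ^ (-n : ℝ)) =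
      ENNReal.ofReal (s ^ (n - 1))⁻¹ := by
  have hn' : (2 : ℝ) ≤ n := by exact_mod_cast hn
  rw [← ofReal_integral_eq_lintegral_ofReal
    ((integrableOn_Ioi_rpow_of_lt (by linarith) hs).const_mul _)]
  · congr 1
    rw [integral_const_mul, integral_Ioi_rpow_of_lt (by linarith) hs,
      ← Real.rpow_natCast, ← Real.rpow_neg hs.le, Nat.cast_sub (by omega), Nat.cast_one,
      show -(n : ℝ) + 1 = -(n - 1) by ring, neg_div_neg_eq, mul_div_cancel₀]
    linarith
  · filter_upwards [ae_restrict_mem measurableSet_Ioi] with t ht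
    have : 0 < t := hs.trans ht
    exact mul_nonneg (by linarith) (by positivity)

/-- If `g` has integral at least `1` along every ray from `x`, its integral against the kernel
`|y - x| ^ (1 - n)` is at least the area of the sphere; the kernel is written as the integral of
`(n - 1) t ^ (-n)` over `t > |y - x|`. -/
lemma le_lintegral_lintegral_ball {n : ℕ} (hn : 2 ≤ n) {g : Rn n → ℝ≥0∞} (hg : Measurable g)
    (x : Rn n) (hx : ∀ e : Rn n, ‖e‖ = 1 → 1 ≤ ∫⁻ t in Ioi (0 : ℝ), g (x + t • e)) :
    ENNReal.ofReal (n * unitBallVol n) ≤ ∫⁻ t in Ioi (0 : ℝ),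
      ENNReal.ofReal ((n - 1) * t ^ (-n : ℝ)) * ∫⁻ y in ball x t, g y := by
  set w : ℝ → ℝ≥0∞ := fun t => ENNReal.ofReal ((n - 1) * t ^ (-n : ℝ)) with hw
  have hwm : Measurable w := by fun_prop
  set k : ℝ → ℝ≥0∞ := fun s => ∫⁻ t in Ioi (0 : ℝ), (Ioi s).indicator w t with hk
  have hkm : Measurable k := by
    have : Measurable (Function.uncurry fun s t : ℝ => (Ioi s).indicator w t) := by
      have e : (Function.uncurry fun s t : ℝ => (Ioi s).indicator w t) =
          {p : ℝ × ℝ | p.1 < p.2}.indicator fun p => w p.2 := by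
        ext ⟨s, t⟩; simp [indicator]
      rw [e]
      exact (hwm.comp measurable_snd).indicator (measurableSet_lt measurable_fst measurable_snd)
    exact this.lintegral_prod_right
  have hk1 : ∀ s : ℝ, 0 < s → ENNReal.ofReal (s ^ (n - 1)) * k s = 1 := by
    intro s hs
    have : k s = ENNReal.ofReal (s ^ (n - 1))⁻¹ := by
      rw [← lintegral_Ioi_rpow_neg hn hs, hk]
      simp only
      rw [lintegral_indicator measurableSet_Ioi, Measure.restrict_restrict measurableSet_Ioi,
        inter_eq_left.2 (Ioi_subset_Ioi hs.le)]
    rw [this, ← ENNReal.ofReal_mul (by positivity), mul_inv_cancel₀ (by positivity),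
      ENNReal.ofReal_one]
  have h1 : ENNReal.ofReal (n * unitBallVol n) ≤ ∫⁻ y, k ‖y‖ * g (x + y) := by
    rw [lintegral_eq_lintegral_toSphere (by omega) (by fun_prop), ← toSphere_univ, ← lintegral_one]
    refine lintegral_mono fun e => ?_
    have he : ‖(e : Rn n)‖ = 1 := by simp
    refine (hx e he).trans_eq (setLIntegral_congr_fun measurableSet_Ioi fun t ht => ?_)
    have ht' : (0 : ℝ) < t := ht
    rw [norm_smul, he, mul_one, Real.norm_of_nonneg ht'.le, ← mul_assoc, hk1 t ht', one_mul]
  refine h1.trans_eq ?_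
  have h2 : ∫⁻ y, k ‖y‖ * g (x + y) = ∫⁻ y, k ‖y - x‖ * g y := by
    rw [← lintegral_add_left_eq_self (fun y => k ‖y - x‖ * g y) x]
    simp
  rw [h2]
  have h3 : ∀ y, k ‖y - x‖ * g y =
      ∫⁻ t in Ioi (0 : ℝ), w t * (ball x t).indicator g y := by
    intro y
    rw [hk]
    simp only
    rw [← lintegral_mul_const _ (hwm.indicator measurableSet_Ioi)]
    refine lintegral_congr fun t => ?_
    by_cases h : ‖y - x‖ < t
    · rw [indicator_of_mem (by exact h), indicator_of_mem (by rwa [mem_ball_iff_norm])]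
    · rw [indicator_of_notMem (by exact h), indicator_of_notMem (by rwa [mem_ball_iff_norm]),
        zero_mul, mul_zero]
  simp_rw [h3]
  rw [lintegral_lintegral_swap]
  · refine lintegral_congr fun t => ?_
    rw [lintegral_const_mul _ (hg.indicator measurableSet_ball),
      lintegral_indicator measurableSet_ball]
  · have e : (Function.uncurry fun (y : Rn n) (t : ℝ) => w t * (ball x t).indicator g y) =
        {p : Rn n × ℝ | dist p.1 x < p.2}.indicator fun p => w p.2 * g p.1 := by
      ext ⟨y, t⟩; simp [indicator]
    rw [e]
    exact (((hwm.comp measurable_snd).mul (hg.comp measurable_fst)).indicator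
      (measurableSet_lt (by fun_prop) measurable_snd)).aemeasurable

/-- A pointwise form of the capacity estimate: if `g` has integral at least `1` along every ray
from `x`, and total integral too small to come from large distances, then on some ball around `x`
of radius `t < T` the integral of `g ^ n` exceeds `ε t ^ β`. -/
lemma exists_lt_lintegral_ball {n : ℕ} (hn : 2 ≤ n) {β T : ℝ} (hβ : 0 < β) (hT : 0 < T)
    {g : Rn n → ℝ≥0∞} (hg : Measurable g)
    (hgT : ∫⁻ y, g y < ENNReal.ofReal (n * unitBallVol n / 2 * T ^ (n - 1))) (x : Rn n)
    (hx : ∀ e : Rn n, ‖e‖ = 1 → 1 ≤ ∫⁻ t in Ioi (0 : ℝ), g (x + t • e)) :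
    ∃ t, 0 < t ∧ t < T ∧
      ENNReal.ofReal ((β / (2 * (n - 1))) ^ n * unitBallVol n / T ^ β * t ^ β) <
        ∫⁻ y in ball x t, g y ^ n := by
  have hn' : (2 : ℝ) ≤ n := by exact_mod_cast hn
  have hn1 : (0 : ℝ) < n - 1 := by linarith
  have : Nontrivial (Rn n) :=
    Module.nontrivial_of_finrank_pos (R := ℝ) (by rw [finrank_euclideanSpace_fin]; omega)
  have hΩ := unitBallVol_pos n
  set Ω := unitBallVol n
  by_contra! hcon
  -- `D` makes `∫₀ᵀ (n - 1) t ^ (-n) D t ^ (n - 1 + β / n) dt` equal to half of the sphere's area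
  set D : ℝ := Ω * (β / (2 * (n - 1))) / T ^ (β / n) with hD
  have hD0 : 0 < D := by positivity
  have hF : ∀ t, 0 < t → t < T →
      ∫⁻ y in ball x t, g y ≤ ENNReal.ofReal (D * t ^ (n - 1 + β / n : ℝ)) := by
    intro t ht htT
    have h1 := lintegral_pow_le_measure_pow_mul (volume.restrict (ball x t)) (by omega : 1 ≤ n)
      hg.aemeasurable
    rw [Measure.restrict_apply_univ, Measure.addHaar_ball _ _ ht.le, finrank_euclideanSpace_fin,
      ← ofReal_unitBallVol, ← ENNReal.ofReal_mul (by positivity),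
      ← ENNReal.ofReal_pow (by positivity)] at h1
    have h2 := h1.trans (mul_le_mul_right (hcon t ht htT) _)
    rw [← ENNReal.ofReal_mul (by positivity)] at h2
    refine (ENNReal.pow_le_pow_left_iff (by omega : n ≠ 0)).1 (h2.trans_eq ?_)
    rw [← ENNReal.ofReal_pow (by positivity)]
    congr 1
    have e1 : (T ^ (β / n)) ^ n = T ^ β := by
      rw [← Real.rpow_natCast, ← Real.rpow_mul hT.le, div_mul_cancel₀ _ (by positivity)]
    have e2 : (t ^ (n - 1 + β / n : ℝ)) ^ n = (t ^ n) ^ (n - 1) * t ^ β := by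
      rw [Real.rpow_add ht, mul_pow, ← Real.rpow_natCast (t ^ (β / n)), ← Real.rpow_mul ht.le,
        div_mul_cancel₀ _ (by positivity)]
      congr 1
      rw [← pow_mul, mul_comm, pow_mul]
      congr 1
      rw [← Real.rpow_natCast, Nat.cast_sub (by omega), Nat.cast_one]
    have e3 : Ω ^ n = Ω ^ (n - 1) * Ω := by
      rw [← pow_succ, Nat.sub_add_cancel (by omega)]
    rw [mul_pow D, hD, div_pow _ (T ^ (β / n)), mul_pow Ω, e1, e2, e3, mul_pow (t ^ n)]
    change (t ^ n) ^ (n - 1) * Ω ^ (n - 1) * _ = _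
    ring
  -- the balls of radius less than `T` and the others each contribute at most half, the latter
  -- strictly less
  have hmain := le_lintegral_lintegral_ball hn hg x hx
  rw [← Ioo_union_Ici_eq_Ioi hT, lintegral_union measurableSet_Ici (by
    rw [disjoint_left]; intro t h1 h2; exact absurd h1.2 (not_lt.2 h2))] at hmain
  have hA : ∫⁻ t in Ioo 0 T, ENNReal.ofReal ((n - 1) * t ^ (-n : ℝ)) * ∫⁻ y in ball x t, g y
      ≤ ENNReal.ofReal (n * Ω / 2) := by
    have hβn : -1 < β / n - 1 := by
      have : 0 < β / n := by positivity
      linarith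
    calc _ ≤ ∫⁻ t in Ioo 0 T, ENNReal.ofReal ((n - 1) * D * t ^ (β / n - 1 : ℝ)) := by
          refine setLIntegral_mono' measurableSet_Ioo fun t ht => ?_
          refine (mul_le_mul_right (hF t ht.1 ht.2) _).trans_eq ?_
          have := ht.1
          rw [← ENNReal.ofReal_mul (by positivity)]
          congr 1
          rw [show β / n - 1 = -(n : ℝ) + (n - 1 + β / n) by ring,
            Real.rpow_add this (-(n : ℝ))]
          ring
      _ = ∫⁻ t in Ioc 0 T, ENNReal.ofReal ((n - 1) * D * t ^ (β / n - 1 : ℝ)) := by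
          rw [restrict_Ioo_eq_restrict_Ioc]
      _ = ENNReal.ofReal (∫ t in Ioc 0 T, (n - 1) * D * t ^ (β / n - 1 : ℝ)) := by
          refine (ofReal_integral_eq_lintegral_ofReal ?_ ?_).symm
          · exact ((intervalIntegral.intervalIntegrable_rpow' hβn).const_mul _).1
          · filter_upwards [ae_restrict_mem measurableSet_Ioc] with t ht
            have := ht.1
            simp only [Pi.zero_apply]
            positivity
      _ ≤ ENNReal.ofReal (n * Ω / 2) := by
          refine ENNReal.ofReal_le_ofReal (le_of_eq ?_)
          rw [integral_const_mul, ← intervalIntegral.integral_of_le hT.le,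
            integral_rpow (Or.inl hβn), sub_add_cancel, Real.zero_rpow (by positivity), hD]
          field_simp
          ring
  have hB : ∫⁻ t in Ici T, ENNReal.ofReal ((n - 1) * t ^ (-n : ℝ)) * ∫⁻ y in ball x t, g y
      < ENNReal.ofReal (n * Ω / 2) := by
    calc _ ≤ ∫⁻ t in Ici T, ENNReal.ofReal ((n - 1) * t ^ (-n : ℝ)) * ∫⁻ y, g y :=
          lintegral_mono fun t => mul_le_mul_right (setLIntegral_le_lintegral _ _) _
      _ = ENNReal.ofReal (T ^ (n - 1))⁻¹ * ∫⁻ y, g y := by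
          rw [lintegral_mul_const _ (by fun_prop), ← restrict_Ioi_eq_restrict_Ici,
            lintegral_Ioi_rpow_neg hn hT]
      _ < ENNReal.ofReal (T ^ (n - 1))⁻¹ * ENNReal.ofReal (n * Ω / 2 * T ^ (n - 1)) :=
          ENNReal.mul_lt_mul_right (by positivity) ENNReal.ofReal_ne_top hgT
      _ = ENNReal.ofReal (n * Ω / 2) := by
          rw [← ENNReal.ofReal_mul (by positivity)]
          congr 1
          field_simp
  have := hmain.trans_lt (ENNReal.add_lt_add_of_le_of_lt
    (hA.trans_lt ENNReal.ofReal_lt_top).ne hA hB)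
  rw [← ENNReal.ofReal_add (by positivity) (by positivity), add_halves] at this
  exact lt_irrefl _ this

/-! ### Hausdorff content and energy -/

/-- Countable coverings are admitted in place of sequences: unused indices carry empty balls. -/
lemma hausdorffContent_le_tsum_of_countable {n : ℕ} {β : ℝ} (hβ : 0 < β) {C S : Set (Rn n)}
    (hS : S.Countable) {ρ : Rn n → ℝ} (hρ : ∀ x ∈ S, 0 ≤ ρ x) (hC : C ⊆ ⋃ x ∈ S, ball x (ρ x)) :
    hausdorffContent β C ≤ ∑' x : S, ENNReal.ofReal (ρ x ^ β) := by
  obtain ⟨e, he⟩ := hS.exists_injective_nat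
  have hinj : Function.Injective e := he
  let b : ℕ → Rn n := Function.extend e (fun x => (x : Rn n)) 0
  let s : ℕ → ℝ := Function.extend e (fun x => ρ x) 0
  have hs : ∀ k, 0 ≤ s k := by
    intro k
    by_cases h : ∃ x, e x = k
    · obtain ⟨x, rfl⟩ := h
      simp only [s, hinj.extend_apply]
      exact hρ x x.2
    · simp only [s, Function.extend_apply' _ _ _ h, Pi.zero_apply, le_refl]
  have hcov : C ⊆ ⋃ k, ball (b k) (s k) := by
    intro y hy
    obtain ⟨x, hx, hyx⟩ := mem_iUnion₂.1 (hC hy)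
    refine mem_iUnion.2 ⟨e ⟨x, hx⟩, ?_⟩
    simpa only [b, s, hinj.extend_apply] using hyx
  have hsum : ∑' k, ENNReal.ofReal (s k ^ β) = ∑' x : S, ENNReal.ofReal (ρ x ^ β) := by
    rw [← tsum_extend_zero hinj]
    refine tsum_congr fun k => ?_
    by_cases h : ∃ x, e x = k
    · obtain ⟨x, rfl⟩ := h
      simp only [s, hinj.extend_apply]
    · simp only [s, Function.extend_apply' _ _ _ h, Pi.zero_apply, Real.zero_rpow hβ.ne',
        ENNReal.ofReal_zero]
  rw [← hsum]
  exact iInf_le_of_le b <| iInf_le_of_le s <| iInf_le_of_le hs <| iInf_le_of_le hcov le_rfl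

/-- If every point of `C` is the centre of a ball of bounded radius `t` on which `h` has integral
more than `ε t ^ β`, the covering lemma bounds the Hausdorff content of `C` by the integral
of `h`. -/
lemma hausdorffContent_mul_le_lintegral {n : ℕ} {β : ℝ} (hβ : 0 < β) {C : Set (Rn n)} {ε T : ℝ}
    (hε : 0 ≤ ε) {h : Rn n → ℝ≥0∞} (hh : Measurable h)
    (hC : ∀ x ∈ C, ∃ t, 0 < t ∧ t < T ∧ ENNReal.ofReal (ε * t ^ β) < ∫⁻ y in ball x t, h y) :
    hausdorffContent β C * ENNReal.ofReal ε ≤ coveringNumber n * ∫⁻ y, h y := by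
  choose! ρ hρ0 hρT hρ using hC
  obtain ⟨S, hSC, hS, hcov, hN⟩ := coveringBound_coveringNumber n C ρ hρ0
    ⟨T, fun x hx => (hρT x hx).le⟩
  have := hS.to_subtype
  have hpt : ∀ y, ∑' x : S, (ball (x : Rn n) (ρ x)).indicator h y ≤ coveringNumber n * h y := by
    intro y
    have e : ∀ x : S, (ball (x : Rn n) (ρ x)).indicator h y =
        {x : S | y ∈ ball (x : Rn n) (ρ x)}.indicator (fun _ => 1) x * h y := by
      intro x
      by_cases hy : y ∈ ball (x : Rn n) (ρ x)
      · rw [indicator_of_mem hy, indicator_of_mem (by exact hy), one_mul]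
      · rw [indicator_of_notMem hy, indicator_of_notMem (by exact hy), zero_mul]
    simp_rw [e]
    rw [ENNReal.tsum_mul_right, ← tsum_subtype, ENNReal.tsum_set_one]
    refine mul_le_mul_left ?_ _
    -- the sum counts the balls that contain `y`
    have h1 : {x : S | y ∈ ball (x : Rn n) (ρ x)}.encard ≤ coveringNumber n := by
      rw [← Subtype.val_injective.encard_image]
      refine (encard_le_encard ?_).trans (hN y)
      rintro _ ⟨x, hx, rfl⟩
      exact ⟨x.2, hx⟩
    exact_mod_cast ENat.toENNReal_le.2 h1
  calc hausdorffContent β C * ENNReal.ofReal ε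
      ≤ (∑' x : S, ENNReal.ofReal (ρ x ^ β)) * ENNReal.ofReal ε :=
        mul_le_mul_left
          (hausdorffContent_le_tsum_of_countable hβ hS (fun x hx => (hρ0 x (hSC hx)).le) hcov) _
    _ = ∑' x : S, ENNReal.ofReal (ε * ρ x ^ β) := by
        rw [← ENNReal.tsum_mul_right]
        refine tsum_congr fun x => ?_
        rw [mul_comm, ENNReal.ofReal_mul hε]
    _ ≤ ∑' x : S, ∫⁻ y, (ball (x : Rn n) (ρ x)).indicator h y :=
        ENNReal.tsum_le_tsum fun x => by
          rw [lintegral_indicator measurableSet_ball]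
          exact (hρ x (hSC x.2)).le
    _ = ∫⁻ y, ∑' x : S, (ball (x : Rn n) (ρ x)).indicator h y :=
        (lintegral_tsum fun x => (hh.indicator measurableSet_ball).aemeasurable).symm
    _ ≤ ∫⁻ y, coveringNumber n * h y := lintegral_mono hpt
    _ = _ := lintegral_const_mul _ hh

lemma Kconst_pos {n : ℕ} (hn : 2 ≤ n) : 0 < Kconst n := by
  have := unitBallVol_pos n
  have hn' : (2 : ℝ) ≤ n := by exact_mod_cast hn
  rw [Kconst, unitSphereArea]
  positivity

/-- A function on a ball of radius `T` whose integral is not small compared with `T ^ (n - 1)`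
has energy at least `K_n`. -/
lemma Kconst_le_lintegral_pow {n : ℕ} (hn : 2 ≤ n) {T : ℝ} (hT : 0 < T) (a : Rn n)
    {g : Rn n → ℝ≥0∞} (hg : Measurable g) (hga : ∀ y ∉ ball a T, g y = 0)
    (hgT : ENNReal.ofReal (n * unitBallVol n / 2 * T ^ (n - 1)) ≤ ∫⁻ y, g y) :
    ENNReal.ofReal (Kconst n) ≤ ∫⁻ y, g y ^ n := by
  have : Nontrivial (Rn n) :=
    Module.nontrivial_of_finrank_pos (R := ℝ) (by rw [finrank_euclideanSpace_fin]; omega)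
  have hΩ := unitBallVol_pos n
  have h1 : ∫⁻ y, g y = ∫⁻ y in ball a T, g y :=
    (setLIntegral_eq_of_support_subset fun y hy => by
      by_contra h; exact hy (hga y h)).symm
  have h2 := lintegral_pow_le_measure_pow_mul (volume.restrict (ball a T)) (by omega : 1 ≤ n)
    hg.aemeasurable
  rw [Measure.restrict_apply_univ, Measure.addHaar_ball _ _ hT.le, finrank_euclideanSpace_fin,
    ← ofReal_unitBallVol, ← ENNReal.ofReal_mul (by positivity),
    ← ENNReal.ofReal_pow (by positivity), ← h1] at h2
  have h3 := (pow_le_pow_left' hgT n).trans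
    (h2.trans (mul_le_mul_right (setLIntegral_le_lintegral _ _) _))
  have e : (n * unitBallVol n / 2 * T ^ (n - 1)) ^ n =
      (T ^ n * unitBallVol n) ^ (n - 1) * Kconst n := by
    rw [Kconst, unitSphereArea, Real.rpow_sub hΩ, Real.rpow_one, Real.rpow_neg (by norm_num),
      Real.rpow_natCast, Real.rpow_natCast, mul_pow, div_pow, ← pow_mul, mul_comm (n - 1) n,
      pow_mul, mul_pow (T ^ n)]
    have e3 : unitBallVol n ^ n = unitBallVol n ^ (n - 1) * unitBallVol n := by
      rw [← pow_succ, Nat.sub_add_cancel (by omega)]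
    rw [mul_pow, e3]
    field_simp
  rw [← ENNReal.ofReal_pow (by positivity), e, ENNReal.ofReal_mul (by positivity)] at h3
  exact (ENNReal.mul_le_mul_iff_right
    (by rw [Ne, ENNReal.ofReal_eq_zero, not_le]; positivity) ENNReal.ofReal_ne_top).1 h3

lemma M₁_pos {n : ℕ} (hn : 2 ≤ n) (β : ℝ) : 0 < M₁ n β :=
  lt_max_of_lt_right (one_div_pos.2 (Kconst_pos hn))

/-- The estimate behind both capacity bounds: a function on `ball a (2 * r)` that has integral at
least `1` along all rays from the points of a set of large content has large energy. -/
lemma le_lintegral_pow_of_rays {n : ℕ} (hn : 2 ≤ n) {β r : ℝ} (hβ : 0 < β) (hr : 0 < r)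
    {a : Rn n} {C : Set (Rn n)}
    (hC : ENNReal.ofReal (r ^ β / (2 * 3 ^ n)) ≤ hausdorffContent β C)
    {g : Rn n → ℝ≥0∞} (hg : Measurable g) (hga : ∀ y ∉ ball a (2 * r), g y = 0)
    (hx : ∀ x ∈ C, ∀ e : Rn n, ‖e‖ = 1 → 1 ≤ ∫⁻ t in Ioi (0 : ℝ), g (x + t • e)) :
    ENNReal.ofReal (1 / (2 * 3 ^ n * M₁ n β)) ≤ ∫⁻ y, g y ^ n := by
  have hn' : (2 : ℝ) ≤ n := by exact_mod_cast hn
  have hn1 : (0 : ℝ) < n - 1 := by linarith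
  have hΩ := unitBallVol_pos n
  have hM := M₁_pos hn β
  have hK := Kconst_pos hn
  rcases le_or_gt (ENNReal.ofReal (n * unitBallVol n / 2 * (2 * r) ^ (n - 1))) (∫⁻ y, g y)
    with hlarge | hsmall
  · refine (ENNReal.ofReal_le_ofReal ?_).trans
      (Kconst_le_lintegral_pow hn (by positivity) a hg hga hlarge)
    have h1 : 1 / Kconst n ≤ M₁ n β := le_max_right _ _
    have h3 : (1 : ℝ) ≤ 3 ^ n := one_le_pow₀ (by norm_num)
    rw [div_le_iff₀ hK] at h1
    rw [div_le_iff₀ (by positivity)]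
    nlinarith [mul_pos hK hM]
  set ε := (β / (2 * (n - 1))) ^ n * unitBallVol n / (2 * r) ^ β with hε
  have hε0 : 0 < ε := by positivity
  have h1 := hausdorffContent_mul_le_lintegral hβ hε0.le (hg.pow_const n) fun x hxC =>
    exists_lt_lintegral_ball hn hβ (by positivity : 0 < 2 * r) hg hsmall x (hx x hxC)
  by_cases htop : ∫⁻ y, g y ^ n = ∞
  · rw [htop]; exact le_top
  rw [← ENNReal.ofReal_toReal htop] at h1 ⊢
  set i := (∫⁻ y, g y ^ n).toReal with hi
  have hi0 : 0 ≤ i := ENNReal.toReal_nonneg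
  have h2 := (mul_le_mul_left hC (ENNReal.ofReal ε)).trans h1
  rw [← ENNReal.ofReal_mul (by positivity), ← ENNReal.ofReal_natCast,
    ← ENNReal.ofReal_mul (by positivity), ENNReal.ofReal_le_ofReal_iff (by positivity)] at h2
  refine ENNReal.ofReal_le_ofReal ?_
  -- the first entry of the maximum `M₁ n β`
  have hM1 : coveringNumber n / (ε * r ^ β) ≤ M₁ n β := by
    refine le_of_eq_of_le ?_ (le_max_left _ _)
    rw [hε, Real.mul_rpow (by norm_num) hr.le, Real.rpow_add (by norm_num), Real.rpow_natCast,
      div_pow, mul_pow, div_pow]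
    field_simp
  have hrβ : 0 < r ^ β := by positivity
  have hεr : 0 < ε * r ^ β := by positivity
  rw [div_le_iff₀ hεr] at hM1
  rw [div_le_iff₀ (by positivity)]
  rw [div_mul_eq_mul_div, div_le_iff₀ (by positivity)] at h2
  refine le_of_mul_le_mul_left ?_ hεr
  calc ε * r ^ β * 1 = r ^ β * ε := by ring
    _ ≤ coveringNumber n * i * (2 * 3 ^ n) := h2
    _ ≤ M₁ n β * (ε * r ^ β) * i * (2 * 3 ^ n) := by gcongr
    _ = ε * r ^ β * (i * (2 * 3 ^ n * M₁ n β)) := by ring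

/-! ### Modulus: radial segments -/

section Segment

variable {n : ℕ} {x e : Rn n} {L : ℝ}

lemma eVariationOn_segment (he : ‖e‖ = 1) (hL : 0 ≤ L) {b : ℝ} (hb : b ∈ Icc (0 : ℝ) 1) :
    eVariationOn (fun s : ℝ => x + (s * L) • e) (Icc 0 1 ∩ Icc 0 b) = ENNReal.ofReal (b * L) := by
  have hmono : MonotoneOn (fun s : ℝ => s * L) (Icc 0 1) :=
    fun s _ t _ hst => mul_le_mul_of_nonneg_right hst hL
  have h := hmono.eVariationOn_eq (a := 0) (b := b) ⟨le_rfl, zero_le_one⟩ hb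
  rw [zero_mul, sub_zero] at h
  rw [← h]
  have hed : ∀ s t : ℝ, edist (x + (s * L) • e) (x + (t * L) • e) = edist (s * L) (t * L) := by
    intro s t
    rw [edist_dist, edist_dist, dist_add_left, dist_eq_norm, ← sub_smul, norm_smul, he, mul_one,
      Real.dist_eq, Real.norm_eq_abs]
  simp only [eVariationOn, hed]

/-- The natural parametrization of a segment is affine, so line integrals along it are ordinary
integrals. -/
lemma lineIntegral_segment (he : ‖e‖ = 1) (hL : 0 ≤ L) (ρ : Rn n → ℝ≥0∞) :
    curveLength (fun s : ℝ => x + (s * L) • e) = ENNReal.ofReal L ∧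
    lineIntegral ρ (fun s : ℝ => x + (s * L) • e) = ∫⁻ t in Icc 0 L, ρ (x + t • e) := by
  have hlen : curveLength (fun s : ℝ => x + (s * L) • e) = ENNReal.ofReal L := by
    have := eVariationOn_segment (x := x) he hL (b := 1) ⟨zero_le_one, le_rfl⟩
    rwa [inter_self, one_mul] at this
  have hbv : LocallyBoundedVariationOn (fun s : ℝ => x + (s * L) • e) (Icc 0 1) := by
    refine BoundedVariationOn.locallyBoundedVariationOn ?_
    change curveLength (fun s : ℝ => x + (s * L) • e) ≠ ∞
    rw [hlen]
    exact ENNReal.ofReal_ne_top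
  refine ⟨hlen, ?_⟩
  rw [lineIntegral, hlen, ENNReal.toReal_ofReal hL]
  refine setLIntegral_congr_fun measurableSet_Icc fun t ht => ?_
  rcases hL.eq_or_lt with rfl | hL
  · have ht0 : t = 0 := le_antisymm ht.2 ht.1
    simp only [naturalParameterization, Function.comp, mul_zero, ht0]
  have hb : t / L ∈ Icc (0 : ℝ) 1 := ⟨div_nonneg ht.1 hL.le, (div_le_one hL).2 ht.2⟩
  have h1 := edist_naturalParameterization_eq_zero hbv (a := 0) ⟨le_rfl, zero_le_one⟩ hb
  rw [variationOnFromTo.eq_of_le _ _ hb.1, eVariationOn_segment he hL.le hb,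
    div_mul_cancel₀ _ hL.ne', ENNReal.toReal_ofReal ht.1, edist_eq_zero] at h1
  rw [h1]

/-- A ray from a point of a ball leaves every larger concentric ball exactly once. -/
lemma exists_exit_time {a : Rn n} {R : ℝ} (hx : dist x a < R) (he : ‖e‖ = 1) :
    ∃ L : ℝ, 0 < L ∧ dist (x + L • e) a = R ∧ ∀ t : ℝ, 0 ≤ t → t < L → dist (x + t • e) a < R := by
  have hR : 0 < R := dist_nonneg.trans_lt hx
  have hcont : Continuous fun t : ℝ => dist (x + t • e) a := by fun_prop
  have hfar : R ≤ dist (x + (2 * R) • e) a := by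
    have h1 : dist (x + (2 * R) • e) x = 2 * R := by
      rw [dist_eq_norm, add_sub_cancel_left, norm_smul, he, mul_one,
        Real.norm_of_nonneg (by positivity)]
    have h2 := dist_triangle_right (x + (2 * R) • e) x a
    linarith
  obtain ⟨L, hL, hLR⟩ := intermediate_value_Icc (by positivity : (0 : ℝ) ≤ 2 * R)
    hcont.continuousOn ⟨by simpa using hx.le, hfar⟩
  simp only at hLR
  have hL0 : 0 < L := by
    refine hL.1.lt_of_ne ?_
    rintro rfl
    rw [zero_smul, add_zero] at hLR
    exact hx.ne hLR
  refine ⟨L, hL0, hLR, fun t ht0 htL => ?_⟩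
  -- the distance to `a` is convex along the ray
  have hs : 0 < 1 - t / L := by rw [sub_pos, div_lt_one hL0]; exact htL
  have e1 : x + t • e - a = (1 - t / L) • (x - a) + (t / L) • (x + L • e - a) := by
    have : t = t / L * L := by field_simp
    conv_lhs => rw [this]
    module
  rw [dist_eq_norm] at hx hLR ⊢
  rw [e1]
  calc _ ≤ (1 - t / L) * ‖x - a‖ + t / L * ‖x + L • e - a‖ := by
        refine (norm_add_le _ _).trans_eq ?_
        rw [norm_smul, norm_smul, Real.norm_of_nonneg hs.le, Real.norm_of_nonneg (by positivity)]
    _ < (1 - t / L) * R + t / L * R := by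
        rw [hLR]
        gcongr
    _ = R := by ring

end Segment

/-- The modulus bound: radial segments show that an admissible metric restricted to
`ball a (2 * r)` has integral at least `1` along all rays from the points of `E`. -/
lemma le_relCap {n : ℕ} (hn : 2 ≤ n) {β r : ℝ} (hβ : 0 < β) (hr : 0 < r)
    {a : Rn n} {E : Set (Rn n)}
    (hE : ENNReal.ofReal (r ^ β / (2 * 3 ^ n)) ≤ hausdorffContent β (E ∩ closedBall a r)) :
    ENNReal.ofReal (1 / (2 * 3 ^ n * M₁ n β)) ≤ relCap a E r := by
  refine le_iInf₂ fun ρ hρ => ?_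
  have hmeas : Measurable ((ball a (2 * r)).indicator ρ) := hρ.1.indicator measurableSet_ball
  refine (le_lintegral_pow_of_rays hn hβ hr hE hmeas
    (fun y hy => indicator_of_notMem hy _) ?_).trans
    (lintegral_mono fun y => pow_le_pow_left' (indicator_le_self _ _ y) n)
  intro x hx e he
  have hx2 : dist x a < 2 * r := (mem_closedBall.1 hx.2).trans_lt (by linarith)
  obtain ⟨L, hL, hLS, hLt⟩ := exists_exit_time hx2 he
  obtain ⟨hlen, hint⟩ := lineIntegral_segment (x := x) he hL.le ρ
  have hmem : (fun s : ℝ => x + (s * L) • e) ∈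
      joiningCurves (sphere a (2 * r)) (E ∩ closedBall a r) univ := by
    refine ⟨by unfold IsCurve; fun_prop, Or.inr ⟨?_, ?_⟩, fun _ _ => mem_univ _⟩
    · simpa using hx
    · simpa only [one_mul, mem_sphere] using hLS
  refine (hρ.2 _ hmem (by rw [hlen]; exact ENNReal.ofReal_ne_top)).trans ?_
  rw [hint, ← restrict_Ioo_eq_restrict_Icc]
  calc ∫⁻ t in Ioo 0 L, ρ (x + t • e)
      = ∫⁻ t in Ioo 0 L, (ball a (2 * r)).indicator ρ (x + t • e) :=
        setLIntegral_congr_fun measurableSet_Ioo fun t ht =>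
          (indicator_of_mem (mem_ball.2 (hLt t ht.1.le ht.2)) ρ).symm
    _ ≤ _ := lintegral_mono_set Ioo_subset_Ioi_self

/-! ### Capacity: regularization of test functions -/

section Partial

variable {n : ℕ} {u : Rn n → ℝ}

lemma measurable_partialDeriv (hu : Continuous u) (i : Fin n) : Measurable (partialDeriv i u) :=
  measurable_lineDeriv hu

lemma measurable_grad (hu : Continuous u) : Measurable (grad u) := by
  unfold grad
  exact (WithLp.measurable_toLp 2 (Fin n → ℝ)).comp
    (measurable_pi_lambda _ fun i => measurable_partialDeriv hu i)

lemma partialDeriv_eq_zero_of_notMem_tsupport (i : Fin n) {x : Rn n} (hx : x ∉ tsupport u) :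
    partialDeriv i u x = 0 := by
  have h : u =ᶠ[nhds x] fun _ => (0 : ℝ) := notMem_tsupport_iff_eventuallyEq.1 hx
  rw [partialDeriv, h.lineDeriv_eq]
  simp [lineDeriv]

lemma grad_eq_zero_of_notMem_tsupport {x : Rn n} (hx : x ∉ tsupport u) : grad u x = 0 := by
  ext i
  exact partialDeriv_eq_zero_of_notMem_tsupport i hx

lemma IsACLn.integrable_partialDeriv (hu : IsACLn u) (hn : 1 ≤ n) (hc : HasCompactSupport u)
    (i : Fin n) : Integrable (partialDeriv i u) := by
  have : IsFiniteMeasure (volume.restrict (tsupport u)) :=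
    ⟨by rw [Measure.restrict_apply_univ]; exact hc.measure_lt_top⟩
  have h1 := (hu.2.2 i (tsupport u) hc).integrable (by exact_mod_cast hn)
  refine (integrableOn_iff_integrable_of_support_subset ?_).1 h1
  intro x hx
  by_contra h
  exact hx (partialDeriv_eq_zero_of_notMem_tsupport i h)

/-- Absolute continuity on almost every line, as the fundamental theorem of calculus. -/
lemma IsACLn.ae_integral_partialDeriv (hu : IsACLn u) (i : Fin n) :
    ∀ᵐ y : Rn n, ∀ T : ℝ,
      ∫ t in (0 : ℝ)..T, partialDeriv i u (y + t • EuclideanSpace.single i 1) =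
        u (y + T • EuclideanSpace.single i 1) - u y := by
  filter_upwards [hu.2.1 i] with y hy T
  have h := (hy 0 T).integral_deriv_eq_sub
  rw [zero_smul, add_zero] at h
  rw [← h]
  refine intervalIntegral.integral_congr fun t _ => ?_
  simp only [partialDeriv, lineDeriv]
  have e : (fun s : ℝ => u (y + t • EuclideanSpace.single i 1 + s • EuclideanSpace.single i 1)) =
      fun s => (fun r : ℝ => u (y + r • EuclideanSpace.single i 1)) (t + s) := by
    ext s
    simp only [add_smul, add_assoc]
  rw [e, deriv_comp_const_add (fun r : ℝ => u (y + r • EuclideanSpace.single i 1)), add_zero]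

end Partial

open scoped Convolution
open ContinuousLinearMap (lsmul)

section Mollify

variable {n : ℕ} {u : Rn n → ℝ} (φ : ContDiffBump (0 : Rn n))

/-- Mollification of a function by a normalized bump function. -/
noncomputable def mollify (u : Rn n → ℝ) : Rn n → ℝ :=
  φ.normed volume ⋆[lsmul ℝ ℝ, volume] u

lemma mollify_apply (u : Rn n → ℝ) (x : Rn n) :
    mollify φ u x = ∫ z, φ.normed volume z * u (x - z) := rfl

lemma contDiff_mollify (hu : LocallyIntegrable u) : ContDiff ℝ 1 (mollify φ u) :=
  φ.hasCompactSupport_normed.contDiff_convolution_left _ φ.contDiff_normed hu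

lemma integrable_mollify (hu : LocallyIntegrable u) (x : Rn n) :
    Integrable fun z => φ.normed volume z * u (x - z) :=
  φ.hasCompactSupport_normed.convolutionExists_left (lsmul ℝ ℝ) φ.continuous_normed hu x

/-- Mollification commutes with the partial derivatives of `ACLⁿ` functions. -/
lemma IsACLn.fderiv_mollify (hu : IsACLn u) (hn : 1 ≤ n) (hc : HasCompactSupport u) (i : Fin n)
    (x : Rn n) : fderiv ℝ (mollify φ u) x (EuclideanSpace.single i 1) =
      mollify φ (partialDeriv i u) x := by
  set e : Rn n := EuclideanSpace.single i 1 with he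
  set p := partialDeriv i u with hp
  have hpm : Measurable p := measurable_partialDeriv hu.1 i
  have hpi : Integrable p := hu.integrable_partialDeriv hn hc i
  have hul : LocallyIntegrable u := hu.1.locallyIntegrable
  have hφm : Measurable (φ.normed volume) := (φ.continuous_normed (μ := volume)).measurable
  obtain ⟨B, hB⟩ := (φ.hasCompactSupport_normed (μ := volume)).exists_bound_of_continuous
    φ.continuous_normed
  have hB0 : 0 ≤ B := (norm_nonneg _).trans (hB 0)
  -- increments of the mollified function are integrals of the mollified partial derivative
  have hincr : ∀ T : ℝ, mollify φ u (x + T • e) - mollify φ u x =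
      ∫ t in (0 : ℝ)..T, mollify φ p (x + t • e) := by
    intro T
    -- Fubini's theorem applies: the bump is bounded and `p` is integrable
    have hint : Integrable (Function.uncurry fun (t : ℝ) (z : Rn n) =>
        φ.normed volume z * p (x + t • e - z)) ((volume.restrict (uIoc 0 T)).prod volume) := by
      have hm : Measurable (Function.uncurry fun (t : ℝ) (z : Rn n) =>
          φ.normed volume z * p (x + t • e - z)) := by
        have h1 : Measurable fun q : ℝ × Rn n => φ.normed volume q.2 := hφm.comp measurable_snd
        have h2 : Measurable fun q : ℝ × Rn n => p (x + q.1 • e - q.2) := hpm.comp (by fun_prop)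
        exact h1.mul h2
      rw [integrable_prod_iff hm.aestronglyMeasurable]
      refine ⟨Filter.Eventually.of_forall fun t =>
        integrable_mollify φ hpi.locallyIntegrable (x + t • e), ?_⟩
      have : IsFiniteMeasure (volume.restrict (uIoc (0 : ℝ) T)) :=
        inferInstanceAs (IsFiniteMeasure (volume.restrict (Ioc _ _)))
      refine Integrable.mono' (integrable_const (B * ∫ z, ‖p z‖))
        hm.norm.stronglyMeasurable.integral_prod_right.aestronglyMeasurable
        (Filter.Eventually.of_forall fun t => ?_)
      rw [Real.norm_of_nonneg (integral_nonneg fun z => norm_nonneg _),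
        ← integral_sub_left_eq_self (fun z => ‖p z‖) volume (x + t • e), ← integral_const_mul]
      refine integral_mono (integrable_mollify φ hpi.locallyIntegrable (x + t • e)).norm
        ((hpi.comp_sub_left (x + t • e)).norm.const_mul B) fun z => ?_
      simp only [Function.uncurry, norm_mul]
      exact mul_le_mul_of_nonneg_right (hB z) (norm_nonneg _)
    have hae : ∀ᵐ z : Rn n, ∀ T : ℝ, ∫ t in (0 : ℝ)..T, p (x - z + t • e) =
        u (x - z + T • e) - u (x - z) :=
      (quasiMeasurePreserving_sub_left volume x).ae (hu.ae_integral_partialDeriv i)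
    simp only [mollify_apply]
    rw [intervalIntegral_integral_swap hint,
      ← integral_sub (integrable_mollify φ hul (x + T • e)) (integrable_mollify φ hul x)]
    refine integral_congr_ae ?_
    filter_upwards [hae] with z hz
    have h1 : ∀ t : ℝ, x + t • e - z = x - z + t • e := fun t => by abel
    simp only [h1]
    rw [intervalIntegral.integral_const_mul, hz T, mul_sub]
  have hcont : Continuous fun t : ℝ => mollify φ p (x + t • e) :=
    (contDiff_mollify φ hpi.locallyIntegrable).continuous.comp (by fun_prop)
  have h1 : HasDerivAt (fun T : ℝ => mollify φ u (x + T • e)) (mollify φ p x) 0 := by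
    have h2 := (intervalIntegral.integral_hasDerivAt_right (hcont.intervalIntegrable 0 0)
      (hcont.stronglyMeasurableAtFilter _ _) hcont.continuousAt).const_add (mollify φ u x)
    simp only [← hincr, add_sub_cancel, zero_smul, add_zero] at h2
    exact h2
  have h2 : HasLineDerivAt ℝ (mollify φ u) (fderiv ℝ (mollify φ u) x e) x e :=
    (((contDiff_mollify φ hul).differentiable one_ne_zero) x).hasFDerivAt.hasLineDerivAt e
  exact HasDerivAt.unique h2 h1

/-- The probability measure with density the normalized bump function. -/
noncomputable def bumpMeasure : Measure (Rn n) :=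
  volume.withDensity fun z => ENNReal.ofReal (φ.normed volume z)

lemma measurable_ofReal_normed : Measurable fun z => ENNReal.ofReal (φ.normed volume z) :=
  (φ.continuous_normed (μ := volume)).measurable.ennreal_ofReal

instance : IsProbabilityMeasure (bumpMeasure φ) := by
  constructor
  rw [bumpMeasure, withDensity_apply _ MeasurableSet.univ, Measure.restrict_univ,
    ← ofReal_integral_eq_lintegral_ofReal φ.integrable_normed
      (Filter.Eventually.of_forall φ.nonneg_normed), φ.integral_normed, ENNReal.ofReal_one]

lemma measurable_lintegral_sub_bumpMeasure {h : Rn n → ℝ≥0∞} (hh : Measurable h) :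
    Measurable fun x => ∫⁻ z, h (x - z) ∂bumpMeasure φ :=
  Measurable.lintegral_prod_right' (f := fun q : Rn n × Rn n => h (q.1 - q.2))
    (hh.comp measurable_sub)

/-- Convolution with a probability measure does not increase the energy. -/
lemma lintegral_lintegral_sub_bumpMeasure_pow_le (hn : 1 ≤ n) {h : Rn n → ℝ≥0∞}
    (hh : Measurable h) :
    ∫⁻ x, (∫⁻ z, h (x - z) ∂bumpMeasure φ) ^ n ≤ ∫⁻ x, h x ^ n := by
  calc ∫⁻ x, (∫⁻ z, h (x - z) ∂bumpMeasure φ) ^ n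
      ≤ ∫⁻ x, ∫⁻ z, h (x - z) ^ n ∂bumpMeasure φ := by
        refine lintegral_mono fun x => ?_
        have := lintegral_pow_le_measure_pow_mul (bumpMeasure φ) hn (g := fun z => h (x - z))
          (hh.comp (by fun_prop)).aemeasurable
        rwa [measure_univ, one_pow, one_mul] at this
    _ = ∫⁻ z, (∫⁻ x, h (x - z) ^ n) ∂bumpMeasure φ :=
        lintegral_lintegral_swap ((hh.comp measurable_sub).pow_const n).aemeasurable
    _ = ∫⁻ x, h x ^ n := by
        simp_rw [lintegral_sub_right_eq_self (fun x => h x ^ n)]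
        rw [lintegral_const, measure_univ, mul_one]

/-- The derivative of the mollified function is bounded by the mollified norm of the gradient. -/
lemma IsACLn.enorm_fderiv_mollify_le (hu : IsACLn u) (hn : 1 ≤ n) (hc : HasCompactSupport u)
    (x : Rn n) {e : Rn n} (he : ‖e‖ = 1) :
    ‖fderiv ℝ (mollify φ u) x e‖ₑ ≤ ∫⁻ z, ‖grad u (x - z)‖ₑ ∂bumpMeasure φ := by
  have hesum : e = ∑ i, e i • EuclideanSpace.single i (1 : ℝ) := by
    ext j
    simp [Pi.single_apply]
  have h1 : fderiv ℝ (mollify φ u) x e =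
      ∫ z, φ.normed volume z * inner ℝ e (grad u (x - z)) := by
    conv_lhs => rw [hesum, map_sum]
    simp only [map_smul, hu.fderiv_mollify φ hn hc, mollify_apply, smul_eq_mul]
    simp_rw [← integral_const_mul]
    rw [← integral_finsetSum]
    · refine integral_congr_ae (Filter.Eventually.of_forall fun z => ?_)
      simp only [PiLp.inner_apply, grad, Finset.mul_sum]
      refine Finset.sum_congr rfl fun i _ => ?_
      simp only [RCLike.inner_apply, conj_trivial]
      ring
    · intro i _
      exact (integrable_mollify φ (hu.integrable_partialDeriv hn hc i).locallyIntegrable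
        x).const_mul _
  have hgm : Measurable fun z => ‖grad u (x - z)‖ₑ :=
    ((measurable_grad hu.1).comp (by fun_prop)).enorm
  rw [h1, bumpMeasure, lintegral_withDensity_eq_lintegral_mul _ (measurable_ofReal_normed φ) hgm]
  refine (enorm_integral_le_lintegral_enorm _).trans (lintegral_mono fun z => ?_)
  rw [enorm_mul, Pi.mul_apply, Real.enorm_of_nonneg (φ.nonneg_normed z)]
  gcongr
  rw [← ofReal_norm, ← ofReal_norm]
  refine ENNReal.ofReal_le_ofReal ((norm_inner_le_norm _ _).trans ?_)
  rw [he, one_mul]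

end Mollify

/-- The capacity bound: after mollification, the fundamental theorem of calculus along rays makes
the (mollified) norm of the gradient of a test function admissible up to a factor close to `1`. -/
lemma le_condenserCap {n : ℕ} (hn : 2 ≤ n) {β r : ℝ} (hβ : 0 < β) (hr : 0 < r)
    {a : Rn n} {E : Set (Rn n)}
    (hE : ENNReal.ofReal (r ^ β / (2 * 3 ^ n)) ≤ hausdorffContent β (E ∩ closedBall a r)) :
    ENNReal.ofReal (1 / (2 * 3 ^ n * M₁ n β)) ≤
      condenserCap (ball a (2 * r)) (E ∩ closedBall a r) := by
  refine le_iInf₂ fun u hu => ?_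
  obtain ⟨hacl, hu0, hc, hsupp, hu1⟩ := hu
  have hcont := hacl.1
  have hgm : Measurable fun y => ‖grad u y‖ₑ := (measurable_grad hcont).enorm
  have key : ∀ q : ℝ, 1 < q → ENNReal.ofReal (1 / (2 * 3 ^ n * M₁ n β)) ≤
      ENNReal.ofReal q ^ n * ∫⁻ y, ‖grad u y‖ₑ ^ n := by
    intro q hq
    have hq0 : 0 < q := one_pos.trans hq
    have hδ : 0 < 1 - 1 / q := by rw [sub_pos, div_lt_one hq0]; exact hq
    obtain ⟨η, hη, hunif⟩ := Metric.uniformContinuous_iff.1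
      (hc.uniformContinuous_of_continuous hcont) _ hδ
    obtain ⟨θ, hθ, hthick⟩ := hc.exists_thickening_subset_open isOpen_ball hsupp
    -- the bump is so narrow that `u` moves by at most `1 - 1 / q` and its support stays in the ball
    set s := min η θ with hs
    have hs0 : 0 < s := lt_min hη hθ
    let φ : ContDiffBump (0 : Rn n) := ⟨s / 2, s, by positivity, by linarith⟩
    have hφ : ∀ z, s ≤ ‖z‖ → φ.normed volume z = 0 := by
      intro z hz
      have : z ∉ Function.support (φ.normed volume) := by
        rw [φ.support_normed_eq, mem_ball_zero_iff, not_lt]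
        exact hz
      exact Function.notMem_support.1 this
    have hout : ∀ y ∉ ball a (2 * r), ∀ z, ‖z‖ < s → y - z ∉ tsupport u := by
      intro y hy z hz hyz
      refine hy (hthick (mem_thickening_iff.2 ⟨_, hyz, ?_⟩))
      rw [dist_eq_norm, sub_sub_cancel]
      exact hz.trans_le (min_le_right _ _)
    have hv0 : ∀ y ∉ ball a (2 * r), mollify φ u y = 0 := by
      intro y hy
      rw [mollify_apply]
      refine integral_eq_zero_of_ae (Filter.Eventually.of_forall fun z => ?_)
      rcases lt_or_ge ‖z‖ s with hz | hz
      · simp only [image_eq_zero_of_notMem_tsupport (hout y hy z hz), mul_zero, Pi.zero_apply]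
      · simp only [hφ z hz, zero_mul, Pi.zero_apply]
    set G : Rn n → ℝ≥0∞ := fun y => ∫⁻ z, ‖grad u (y - z)‖ₑ ∂bumpMeasure φ with hG
    have hGm : Measurable G := measurable_lintegral_sub_bumpMeasure φ hgm
    have hG0 : ∀ y ∉ ball a (2 * r), G y = 0 := by
      intro y hy
      rw [hG]
      simp only
      rw [bumpMeasure, lintegral_withDensity_eq_lintegral_mul _ (measurable_ofReal_normed φ)
        (show Measurable fun z => ‖grad u (y - z)‖ₑ from hgm.comp (by fun_prop))]
      refine (lintegral_congr fun z => ?_).trans lintegral_zero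
      rcases lt_or_ge ‖z‖ s with hz | hz
      · simp only [Pi.mul_apply, grad_eq_zero_of_notMem_tsupport (hout y hy z hz), enorm_zero,
          mul_zero]
      · simp only [Pi.mul_apply, hφ z hz, ENNReal.ofReal_zero, zero_mul]
    have hv1 : ∀ x ∈ E ∩ closedBall a r, 1 / q ≤ mollify φ u x := by
      intro x hx
      have h1 : dist (mollify φ u x) (u x) ≤ 1 - 1 / q :=
        φ.dist_normed_convolution_le hcont.aestronglyMeasurable fun y hy =>
          (hunif (lt_of_lt_of_le hy (min_le_left _ _))).le
      rw [Real.dist_eq] at h1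
      linarith [(abs_le.1 h1).1, hu1 x hx]
    have hv : ContDiff ℝ 1 (mollify φ u) := contDiff_mollify φ hcont.locallyIntegrable
    refine (le_lintegral_pow_of_rays hn hβ hr hE (a := a)
      (g := fun y => ENNReal.ofReal q * G y)
      (hGm.const_mul _) (fun y hy => by simp only [hG0 y hy, mul_zero]) ?_).trans ?_
    · intro x hx e he
      have hx2 : dist x a < 2 * r := (mem_closedBall.1 hx.2).trans_lt (by linarith)
      obtain ⟨L, hL, hLS, -⟩ := exists_exit_time hx2 he
      have hderiv : ∀ t : ℝ, HasDerivAt (fun t : ℝ => mollify φ u (x + t • e))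
          (fderiv ℝ (mollify φ u) (x + t • e) e) t := by
        intro t
        have h1 : HasDerivAt (fun t : ℝ => x + t • e) e t := by
          simpa using ((hasDerivAt_id t).smul_const e).const_add x
        exact ((hv.differentiable one_ne_zero) (x + t • e)).hasFDerivAt.comp_hasDerivAt t h1
      have hcd : Continuous fun t : ℝ => fderiv ℝ (mollify φ u) (x + t • e) e :=
        ((hv.continuous_fderiv one_ne_zero).comp (by fun_prop)).clm_apply continuous_const
      have hftc := intervalIntegral.integral_eq_sub_of_hasDerivAt (a := 0) (b := L)
        (fun t _ => hderiv t) (hcd.intervalIntegrable 0 L)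
      rw [hv0 _ (by rw [mem_ball, hLS]; exact lt_irrefl _), zero_smul, add_zero, zero_sub,
        intervalIntegral.integral_of_le hL.le] at hftc
      have h1 : ENNReal.ofReal (1 / q) ≤ ∫⁻ t in Ioi (0 : ℝ), G (x + t • e) := by
        calc ENNReal.ofReal (1 / q) ≤ ‖-mollify φ u x‖ₑ := by
              rw [enorm_neg, ← ofReal_norm]
              exact ENNReal.ofReal_le_ofReal ((hv1 x hx).trans (Real.le_norm_self _))
          _ ≤ ∫⁻ t in Ioc 0 L, ‖fderiv ℝ (mollify φ u) (x + t • e) e‖ₑ := by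
              rw [← hftc]
              exact enorm_integral_le_lintegral_enorm _
          _ ≤ ∫⁻ t in Ioc 0 L, G (x + t • e) := lintegral_mono fun t =>
              hacl.enorm_fderiv_mollify_le φ (by omega) hc (x + t • e) he
          _ ≤ _ := lintegral_mono_set Ioc_subset_Ioi_self
      rw [lintegral_const_mul _ (show Measurable fun t : ℝ => G (x + t • e) from
        hGm.comp (by fun_prop))]
      calc (1 : ℝ≥0∞) = ENNReal.ofReal q * ENNReal.ofReal (1 / q) := by
            rw [← ENNReal.ofReal_mul hq0.le, mul_one_div_cancel hq0.ne', ENNReal.ofReal_one]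
        _ ≤ _ := mul_le_mul_right h1 _
    · simp_rw [mul_pow]
      rw [lintegral_const_mul _ (hGm.pow_const n)]
      exact mul_le_mul_right
        (lintegral_lintegral_sub_bumpMeasure_pow_le φ (by omega) hgm) _
  have hlim : Filter.Tendsto (fun q : ℝ => ENNReal.ofReal q ^ n * ∫⁻ y, ‖grad u y‖ₑ ^ n)
      (nhdsWithin 1 (Ioi 1)) (nhds (ENNReal.ofReal 1 ^ n * ∫⁻ y, ‖grad u y‖ₑ ^ n)) := by
    refine ENNReal.Tendsto.mul_const (ENNReal.Tendsto.pow ?_) (Or.inl (by simp))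
    exact (ENNReal.continuous_ofReal.tendsto 1).mono_left nhdsWithin_le_nhds
  rw [ENNReal.ofReal_one, one_pow, one_mul] at hlim
  exact ge_of_tendsto hlim (by filter_upwards [self_mem_nhdsWithin] with q hq using key q hq)

end UnifPerfect

/-! ### Bounds for uniformly perfect sets -/

theorem mainTheorem4 (n : ℕ) (hn : 2 ≤ n) (c : ℝ) (hc0 : 0 < c) (hc1 : c < 1)
    (E : Set (EuclideanSpace ℝ (Fin n))) (hE : E ∈ UnifPerfect.UP n c)
    (a : EuclideanSpace ℝ (Fin n)) (ha : a ∈ E)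
    (β : ℝ) (hβ : β = Real.log 2 / Real.log (3 / c)) :
    (∀ r : ℝ, 0 < r → r < Metric.diam E / 2 →
      ENNReal.ofReal (r ^ β / (2 * 3 ^ n)) ≤
        UnifPerfect.hausdorffContent β (E ∩ Metric.closedBall a r)) ∧
    (∀ r : ℝ, 0 < r → r < Metric.diam E →
      ENNReal.ofReal (1 / (2 * 3 ^ n * UnifPerfect.M₁ n β)) ≤ UnifPerfect.relCap a E r ∧
      ENNReal.ofReal (1 / (2 * 3 ^ n * UnifPerfect.M₁ n β)) ≤
        UnifPerfect.condenserCap (Metric.ball a (2 * r)) (E ∩ Metric.closedBall a r)) := by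
  have h3c : 3 ≤ 3 / c := (le_div_iff₀ hc0).2 (by linarith)
  have hlog : Real.log 2 ≤ Real.log (3 / c) :=
    Real.log_le_log (by norm_num) (by linarith)
  have hlog2 : 0 < Real.log 2 := Real.log_pos (by norm_num)
  have hlog3 : 0 < Real.log (3 / c) := hlog2.trans_le hlog
  have hβ0 : 0 < β := hβ ▸ div_pos hlog2 hlog3
  have hβ1 : β ≤ 1 := hβ ▸ (div_le_one hlog3).2 hlog
  have hqβ : (c / 3) ^ β = 1 / 2 := by
    rw [Real.rpow_def_of_pos (by positivity), ← inv_div, Real.log_inv, hβ, neg_mul,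
      mul_div_cancel₀ _ hlog3.ne', Real.exp_neg, Real.exp_log (by norm_num), one_div]
  have hcontent : ∀ r : ℝ, 0 < r → r < Metric.diam E →
      ENNReal.ofReal (r ^ β / (2 * 3 ^ n)) ≤
        UnifPerfect.hausdorffContent β (E ∩ Metric.closedBall a r) := fun r hr hrd =>
    UnifPerfect.le_hausdorffContent hn hc0 hc1 hE ha hβ0 hβ1 hqβ hr hrd
  refine ⟨fun r hr hrd => hcontent r hr (by linarith), fun r hr hrd =>
    ⟨UnifPerfect.le_relCap hn hβ0 hr (hcontent r hr hrd),
      UnifPerfect.le_condenserCap hn hβ0 hr (hcontent r hr hrd)⟩⟩
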